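/- Let $(\tilde M,\varphi,\xi,\eta,\tilde g)$ be a cosymplectic manifold, that is, a smooth Riemannian manifold with Levi-Civita connection $\tilde\nabla$ and smooth tensor fields $\varphi$ (of type $(1,1)$), $\xi$ (a vector field) and $\eta$ (a one-form) such that $$\varphi^2=-\mathrm{Id}+\eta\otimes\xi,\qquad \eta(\xi)=1,\qquad \tilde g(\varphi X,\varphi Y)=\tilde g(X,Y)-\eta(X)\eta(Y),\qquad \tilde\nabla\varphi=0 .$$ Let $(N_T,g_T)$ and $(N_\perp,g_\perp)$ be Riemannian manifolds, let $f:N_T\to(0,\infty)$ be smooth, and let $M^n=N_T\times_f N_\perp$ be the warped product, i.e. $N_T\times N_\perp$ with the metric $g=\pi_1^*g_T+(f\circ\pi_1)^2\,\pi_2^*g_\perp$. Let $\iota:M^n\to\tilde M$ be a smooth isometric immersion which makes $M^n$ a contact CR-warped product submanifold with $\xi$ tangent to $N_T$: identifying tangent vectors of $M^n$ with their images under $d\iota$, the vector $\xi$ is tangent to $N_T$, $\varphi(TN_T)\subseteq TN_T$, and $\varphi(TN_\perp)\subseteq T^\perp M^n$. Let $h(X,Y)=(\tilde\nabla_XY)^\perp$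 be the second fundamental form of $\iota$. Then $M^n$ is $\mathcal D_T$-minimal: at every point $p\in M^n$ and for every orthonormal basis $e_1,\dots,e_k$ of the invariant distribution $\mathcal D_T=TN_T$ at $p$, $$\sum_{i=1}^{k}h(e_i,e_i)=0 .$$ The same holds for every orthonormal basis of the orthogonal complement of $\xi$ in $TN_T$, which some authors denote by $\mathcal D_T$. -/

import Mathlib

open Bundle Manifold ContDiff

noncomputable section

namespace CosymplecticWarped

/-! All manifolds are real, finite-dimensional, smooth, Hausdorff and without boundary: `M` is
charted on a finite-dimensional space `E`, with the model `𝓘(ℝ, E)`. A Riemannian metric is given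
by `RiemannianBundle (fun x : M ↦ TangentSpace 𝓘(ℝ, E) x)` together with its smoothness
`IsContMDiffRiemannianBundle 𝓘(ℝ, E) ∞ E (fun x : M ↦ TangentSpace 𝓘(ℝ, E) x)`. -/

section Ambient

variable (E : Type*) [NormedAddCommGroup E] [NormedSpace ℝ E] [FiniteDimensional ℝ E]
  (M : Type*) [TopologicalSpace M] [ChartedSpace E M] [IsManifold 𝓘(ℝ, E) ∞ M]
  [RiemannianBundle (fun x : M ↦ TangentSpace 𝓘(ℝ, E) x)]

/-- An almost contact metric structure `(φ, ξ, η, g)` on the Riemannian manifold `(M, g)`: smooth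
tensor fields `φ` (of type `(1,1)`), `ξ` (a vector field) and `η` (a one-form) such that
`φ² = -id + η ⊗ ξ`, `η(ξ) = 1` and `g(φX, φY) = g(X, Y) - η(X) η(Y)`. -/
structure AlmostContactMetricStructure where
  φ : ∀ x : M, TangentSpace 𝓘(ℝ, E) x →L[ℝ] TangentSpace 𝓘(ℝ, E) x
  ξ : ∀ x : M, TangentSpace 𝓘(ℝ, E) x
  η : ∀ x : M, TangentSpace 𝓘(ℝ, E) x →L[ℝ] ℝ
  smooth_φ : ContMDiff 𝓘(ℝ, E) (𝓘(ℝ, E).prod 𝓘(ℝ, E →L[ℝ] E)) ∞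
    (fun x ↦ TotalSpace.mk' (E →L[ℝ] E)
      (E := fun x : M ↦ TangentSpace 𝓘(ℝ, E) x →L[ℝ] TangentSpace 𝓘(ℝ, E) x) x (φ x))
  smooth_ξ : ContMDiff 𝓘(ℝ, E) (𝓘(ℝ, E).prod 𝓘(ℝ, E)) ∞
    (fun x ↦ TotalSpace.mk' E (E := fun x : M ↦ TangentSpace 𝓘(ℝ, E) x) x (ξ x))
  smooth_η : ContMDiff 𝓘(ℝ, E) (𝓘(ℝ, E).prod 𝓘(ℝ, E →L[ℝ] ℝ)) ∞
    (fun x ↦ TotalSpace.mk' (E →L[ℝ] ℝ)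
      (E := fun x : M ↦ TangentSpace 𝓘(ℝ, E) x →L[ℝ] ℝ) x (η x))
  φ_φ : ∀ (x : M) (X : TangentSpace 𝓘(ℝ, E) x), φ x (φ x X) = -X + η x X • ξ x
  η_ξ : ∀ x : M, η x (ξ x) = 1
  inner_φ_φ : ∀ (x : M) (X Y : TangentSpace 𝓘(ℝ, E) x),
    inner ℝ (φ x X) (φ x Y) = inner ℝ X Y - η x X * η x Y

variable {E M}

/-- `∇` is the Levi-Civita connection of `M`: it is torsion-free and metric, i.e.
`v ⟨Y, Z⟩ = ⟨∇_v Y, Z⟩ + ⟨Y, ∇_v Z⟩` for every tangent vector `v` at `x` and all vector fields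
`Y`, `Z` that are differentiable at `x`. -/
def IsLeviCivita
    (nabla : CovariantDerivative 𝓘(ℝ, E) E (fun x : M ↦ TangentSpace 𝓘(ℝ, E) x)) : Prop :=
  nabla.torsion = 0 ∧
  ∀ (x : M) (Y Z : ∀ y : M, TangentSpace 𝓘(ℝ, E) y),
    MDifferentiableAt 𝓘(ℝ, E) (𝓘(ℝ, E).prod 𝓘(ℝ, E))
      (fun y ↦ TotalSpace.mk' E (E := fun y : M ↦ TangentSpace 𝓘(ℝ, E) y) y (Y y)) x →
    MDifferentiableAt 𝓘(ℝ, E) (𝓘(ℝ, E).prod 𝓘(ℝ, E))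
      (fun y ↦ TotalSpace.mk' E (E := fun y : M ↦ TangentSpace 𝓘(ℝ, E) y) y (Z y)) x →
    ∀ v : TangentSpace 𝓘(ℝ, E) x,
      mvfderiv 𝓘(ℝ, E) (fun y ↦ inner ℝ (Y y) (Z y)) x v
        = inner ℝ (nabla Y x v) (Z x) + inner ℝ (Y x) (nabla Z x v)

/-- The almost contact metric structure is cosymplectic with respect to `∇` (which is meant to be
the Levi-Civita connection): `∇φ = 0`, that is, `∇_v (φY) = φ (∇_v Y)` for every tangent vector `v`
at `x` and every vector field `Y` that is differentiable at `x`. -/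
def AlmostContactMetricStructure.IsCosymplectic (S : AlmostContactMetricStructure E M)
    (nabla : CovariantDerivative 𝓘(ℝ, E) E (fun x : M ↦ TangentSpace 𝓘(ℝ, E) x)) : Prop :=
  ∀ (x : M) (Y : ∀ y : M, TangentSpace 𝓘(ℝ, E) y),
    MDifferentiableAt 𝓘(ℝ, E) (𝓘(ℝ, E).prod 𝓘(ℝ, E))
      (fun y ↦ TotalSpace.mk' E (E := fun y : M ↦ TangentSpace 𝓘(ℝ, E) y) y (Y y)) x →
    ∀ v : TangentSpace 𝓘(ℝ, E) x, nabla (fun y ↦ S.φ y (Y y)) x v = S.φ x (nabla Y x v)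

end Ambient

section Immersion

variable {E : Type*} [NormedAddCommGroup E] [NormedSpace ℝ E] [FiniteDimensional ℝ E]
  {M : Type*} [TopologicalSpace M] [ChartedSpace E M] [IsManifold 𝓘(ℝ, E) ∞ M]
  {E' : Type*} [NormedAddCommGroup E'] [NormedSpace ℝ E'] [FiniteDimensional ℝ E']
  {H' : Type*} [TopologicalSpace H'] {I' : ModelWithCorners ℝ E' H'}
  {P : Type*} [TopologicalSpace P] [ChartedSpace H' P] [IsManifold I' 1 P]

variable (I') in
/-- The tangent space `dF(T_p P) ⊆ T_{F p} M` of the immersed manifold `F : P → M` at `p`. -/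
def tangentImage (F : P → M) (p : P) : Submodule ℝ (TangentSpace 𝓘(ℝ, E) (F p)) :=
  LinearMap.range (mfderiv I' 𝓘(ℝ, E) F p).toLinearMap

/-- The covariant derivative `∇_v s` of a vector field `s` along a map `F : P → M`, with respect to
a connection `∇` of `M` (the connection on `F^* TM` induced by `∇`). In the local frame `∂ᵢ` of
`TM` given by the preferred trivialization at `F p`, write `s = ∑ᵢ sⁱ (∂ᵢ ∘ F)` near `p`; then
`∇_v s = ∑ᵢ dsⁱ(v) ∂ᵢ + ∑ᵢ sⁱ(p) ∇_{dF(v)} ∂ᵢ`. In the second term,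
`FiberBundle.extend E (s p)` is the local field `∑ᵢ sⁱ(p) ∂ᵢ`. -/
def covAlong (nabla : CovariantDerivative 𝓘(ℝ, E) E (fun x : M ↦ TangentSpace 𝓘(ℝ, E) x))
    (F : P → M) (s : ∀ p : P, TangentSpace 𝓘(ℝ, E) (F p)) (p : P) (v : TangentSpace I' p) :
    TangentSpace 𝓘(ℝ, E) (F p) :=
  (trivializationAt E (fun x : M ↦ TangentSpace 𝓘(ℝ, E) x) (F p)).symm (F p)
      (mvfderiv I'
        (fun p' ↦ (trivializationAt E (fun x : M ↦ TangentSpace 𝓘(ℝ, E) x) (F p)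
          (TotalSpace.mk' E (F p') (s p'))).2) p v)
    + nabla (FiberBundle.extend E (s p)) (F p) (mfderiv I' 𝓘(ℝ, E) F p v)

/-- The second fundamental form `h(v, w) = (∇_v (dF W))^⊥` at `p` of an immersion `F : P → M`,
where `W` is a local vector field of `P` with `W(p) = w`, and `^⊥` is the component orthogonal to
the tangent space `dF(T_p P)`. -/
def secondFundamentalForm [RiemannianBundle (fun x : M ↦ TangentSpace 𝓘(ℝ, E) x)]
    (nabla : CovariantDerivative 𝓘(ℝ, E) E (fun x : M ↦ TangentSpace 𝓘(ℝ, E) x))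
    (F : P → M) (p : P) (v w : TangentSpace I' p) : TangentSpace 𝓘(ℝ, E) (F p) :=
  haveI : FiniteDimensional ℝ (TangentSpace 𝓘(ℝ, E) (F p)) :=
    inferInstanceAs (FiniteDimensional ℝ E)
  Submodule.starProjection (Submodule.orthogonal (tangentImage I' F p))
    (covAlong nabla F
      (fun p' ↦ mfderiv I' 𝓘(ℝ, E) F p'
        (FiberBundle.extend E' (E := fun q : P ↦ TangentSpace I' q) w p')) p v)

end Immersion

section WarpedProduct

variable {E₁ : Type*} [NormedAddCommGroup E₁] [NormedSpace ℝ E₁]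
  {N₁ : Type*} [TopologicalSpace N₁] [ChartedSpace E₁ N₁]
  {E₂ : Type*} [NormedAddCommGroup E₂] [NormedSpace ℝ E₂]
  {N₂ : Type*} [TopologicalSpace N₂] [ChartedSpace E₂ N₂]

/-- The tangent space at `p` of the leaf `N₁ × {p.2}` of `N₁ × N₂`: the kernel of `dπ₂`. -/
def firstFactor (p : N₁ × N₂) :
    Submodule ℝ (TangentSpace (𝓘(ℝ, E₁).prod 𝓘(ℝ, E₂)) p) :=
  LinearMap.ker
    (mfderiv (𝓘(ℝ, E₁).prod 𝓘(ℝ, E₂)) 𝓘(ℝ, E₂) (Prod.snd : N₁ × N₂ → N₂) p).toLinearMap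

/-- The tangent space at `p` of the leaf `{p.1} × N₂` of `N₁ × N₂`: the kernel of `dπ₁`. -/
def secondFactor (p : N₁ × N₂) :
    Submodule ℝ (TangentSpace (𝓘(ℝ, E₁).prod 𝓘(ℝ, E₂)) p) :=
  LinearMap.ker
    (mfderiv (𝓘(ℝ, E₁).prod 𝓘(ℝ, E₂)) 𝓘(ℝ, E₁) (Prod.fst : N₁ × N₂ → N₁) p).toLinearMap

variable [RiemannianBundle (fun x : N₁ ↦ TangentSpace 𝓘(ℝ, E₁) x)]
  [RiemannianBundle (fun x : N₂ ↦ TangentSpace 𝓘(ℝ, E₂) x)]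

/-- The warped product metric `g = π₁^* g₁ + (f ∘ π₁)² π₂^* g₂` of `N₁ ×_f N₂`. -/
def warpedMetric (f : N₁ → ℝ) (p : N₁ × N₂)
    (v w : TangentSpace (𝓘(ℝ, E₁).prod 𝓘(ℝ, E₂)) p) : ℝ :=
  inner ℝ
      (mfderiv (𝓘(ℝ, E₁).prod 𝓘(ℝ, E₂)) 𝓘(ℝ, E₁) (Prod.fst : N₁ × N₂ → N₁) p v)
      (mfderiv (𝓘(ℝ, E₁).prod 𝓘(ℝ, E₂)) 𝓘(ℝ, E₁) (Prod.fst : N₁ × N₂ → N₁) p w)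
    + f p.1 ^ 2 * inner ℝ
      (mfderiv (𝓘(ℝ, E₁).prod 𝓘(ℝ, E₂)) 𝓘(ℝ, E₂) (Prod.snd : N₁ × N₂ → N₂) p v)
      (mfderiv (𝓘(ℝ, E₁).prod 𝓘(ℝ, E₂)) 𝓘(ℝ, E₂) (Prod.snd : N₁ × N₂ → N₂) p w)

variable {E : Type*} [NormedAddCommGroup E] [NormedSpace ℝ E] [FiniteDimensional ℝ E]
  {M : Type*} [TopologicalSpace M] [ChartedSpace E M] [IsManifold 𝓘(ℝ, E) ∞ M]
  [RiemannianBundle (fun x : M ↦ TangentSpace 𝓘(ℝ, E) x)]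

/-- `F : N₁ ×_f N₂ → M` is a smooth isometric immersion of the warped product: the warping function
`f` is smooth and positive, `F` is smooth, and `F` pulls the metric of `M` back to the warped
product metric (so that every `dF` is injective). -/
structure IsWarpedProductImmersion (f : N₁ → ℝ) (F : N₁ × N₂ → M) : Prop where
  smooth_f : ContMDiff 𝓘(ℝ, E₁) 𝓘(ℝ, ℝ) ∞ f
  f_pos : ∀ x, 0 < f x
  smooth : ContMDiff (𝓘(ℝ, E₁).prod 𝓘(ℝ, E₂)) 𝓘(ℝ, E) ∞ F
  isometric : ∀ (p : N₁ × N₂) (v w : TangentSpace (𝓘(ℝ, E₁).prod 𝓘(ℝ, E₂)) p),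
    inner ℝ (mfderiv (𝓘(ℝ, E₁).prod 𝓘(ℝ, E₂)) 𝓘(ℝ, E) F p v)
      (mfderiv (𝓘(ℝ, E₁).prod 𝓘(ℝ, E₂)) 𝓘(ℝ, E) F p w) = warpedMetric f p v w

/-- The warped product `N₁ ×_f N₂`, isometrically immersed in the almost contact metric manifold
`M`, is a contact CR-warped product of type `N_T ×_f N_⊥` (`N_T = N₁`, `N_⊥ = N₂`) whose factor
`N_T` is tangent to `ξ`: the vector field `ξ` is tangent to `N_T`, the factor `N_T` is invariant
(`φ (T N_T) ⊆ T N_T`), and `N_⊥` is anti-invariant (`φ (T N_⊥) ⊆ (T (N_T ×_f N_⊥))^⊥`). -/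
structure IsContactCRWarpedProduct (S : AlmostContactMetricStructure E M)
    (f : N₁ → ℝ) (F : N₁ × N₂ → M) : Prop extends
    IsWarpedProductImmersion (E₁ := E₁) (E₂ := E₂) (E := E) f F where
  ξ_tangent : ∀ p : N₁ × N₂, ∃ v ∈ firstFactor (E₁ := E₁) (E₂ := E₂) p,
    mfderiv (𝓘(ℝ, E₁).prod 𝓘(ℝ, E₂)) 𝓘(ℝ, E) F p v = S.ξ (F p)
  invariant : ∀ p : N₁ × N₂, ∀ v ∈ firstFactor (E₁ := E₁) (E₂ := E₂) p,
    ∃ w ∈ firstFactor (E₁ := E₁) (E₂ := E₂) p,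
      mfderiv (𝓘(ℝ, E₁).prod 𝓘(ℝ, E₂)) 𝓘(ℝ, E) F p w
        = S.φ (F p) (mfderiv (𝓘(ℝ, E₁).prod 𝓘(ℝ, E₂)) 𝓘(ℝ, E) F p v)
  antiInvariant : ∀ p : N₁ × N₂, ∀ z ∈ secondFactor (E₁ := E₁) (E₂ := E₂) p,
    S.φ (F p) (mfderiv (𝓘(ℝ, E₁).prod 𝓘(ℝ, E₂)) 𝓘(ℝ, E) F p z)
      ∈ Submodule.orthogonal (tangentImage (𝓘(ℝ, E₁).prod 𝓘(ℝ, E₂)) F p)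

/-- `e` is an orthonormal basis, for the warped product metric, of the subspace `D` of the tangent
space at `p`. -/
def IsOrthonormalFrame (f : N₁ → ℝ) (p : N₁ × N₂)
    (D : Submodule ℝ (TangentSpace (𝓘(ℝ, E₁).prod 𝓘(ℝ, E₂)) p)) {k : ℕ}
    (e : Fin k → TangentSpace (𝓘(ℝ, E₁).prod 𝓘(ℝ, E₂)) p) : Prop :=
  (∀ i j, warpedMetric f p (e i) (e j) = if i = j then 1 else 0) ∧
    Submodule.span ℝ (Set.range e) = D

/-- The immersion `F` of the warped product `N₁ ×_f N₂` is `D`-minimal, for a distribution `D` on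
`N₁ × N₂`: at every point the trace `∑ᵢ h(eᵢ, eᵢ)` of the second fundamental form over `D`
vanishes, where `(eᵢ)` is an orthonormal basis of `D`. -/
def IsMinimalOn (nabla : CovariantDerivative 𝓘(ℝ, E) E (fun x : M ↦ TangentSpace 𝓘(ℝ, E) x))
    [IsManifold 𝓘(ℝ, E₁) ∞ N₁] [IsManifold 𝓘(ℝ, E₂) ∞ N₂]
    [FiniteDimensional ℝ E₁] [FiniteDimensional ℝ E₂]
    (f : N₁ → ℝ) (F : N₁ × N₂ → M)
    (D : ∀ p : N₁ × N₂, Submodule ℝ (TangentSpace (𝓘(ℝ, E₁).prod 𝓘(ℝ, E₂)) p)) : Prop :=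
  ∀ (p : N₁ × N₂) (k : ℕ) (e : Fin k → TangentSpace (𝓘(ℝ, E₁).prod 𝓘(ℝ, E₂)) p),
    IsOrthonormalFrame f p (D p) e →
      ∑ i, secondFundamentalForm nabla F p (e i) (e i) = 0

/-- The part of `T N_T` orthogonal to `ξ`: the tangent vectors `v` of the leaf `N₁ × {p.2}` with
`g(dF(v), ξ) = 0`. -/
def firstFactorPerpξ (S : AlmostContactMetricStructure E M) (F : N₁ × N₂ → M) (p : N₁ × N₂) :
    Submodule ℝ (TangentSpace (𝓘(ℝ, E₁).prod 𝓘(ℝ, E₂)) p) :=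
  firstFactor p ⊓
    (Submodule.orthogonal (Submodule.span ℝ {S.ξ (F p)})).comap
      (mfderiv (𝓘(ℝ, E₁).prod 𝓘(ℝ, E₂)) 𝓘(ℝ, E) F p).toLinearMap

end WarpedProduct

end CosymplecticWarped
end

open CosymplecticWarped

open scoped Topology

set_option linter.unusedSectionVars false

namespace CosymplecticWarped

/-! ### Linear algebra of the trace -/

section LinearAlgebra

/-! Let `B(v, w) = ∇_v (dF w)` be the full Hessian of the immersion, before projection to the normal
space, and let `R` be the image of `TN_T` at the point. Since `∇φ = 0` and `φ` maps the images of
the leaf tangent spaces into themselves, differentiating `φ(dF w) = dF(Jw)` gives `φ B(v, w) ≡ B(v,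
Jw)` modulo `R` for `w` in `TN_T` (`exists_hessian_commutator_eq`, transported to the manifold in
`commutator_mem_leafImage`). The unknown derivative of `Jw` contributes only an element of `R`, so
no regularity of `J` has to be established.

Now sum over an orthonormal frame `e_j`. The matrix of `J` is skew because `φ` is, and `B` is
symmetric because the connection is torsion-free, so `∑ B(e_j, J e_j) = 0`. Hence `φ` sends the
trace `∑ B(e_j, e_j)` into `R`. Applying `φ` once more and using `φ² = -id + η ⊗ ξ` with `ξ` in `R`,
the trace itself lies in `R` (`sum_mem_of_skew`). It is therefore tangent, and its normal part, the
trace of `h`, vanishes. The same computation works for any `φ`-invariant subspace of `TN_T`, which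
covers both choices of `D_T`.

The remaining lemmas write `∇`, `φ` and `dF` in the preferred charts at `p` and `F p`, so that the
differentiation is ordinary calculus in vector spaces: there `B` is `D²G + Γ(DG, DG)`. -/

/-- If `B` is symmetric and intertwines, modulo `R`, a skew endomorphism `A` of the span of `e`
with an almost complex structure `Φ` modulo `R`, then the trace of `B` lies in `R`. -/
lemma sum_mem_of_skew {V W : Type*} [AddCommGroup V] [Module ℝ V] [AddCommGroup W] [Module ℝ W]
    (R : Submodule ℝ W) (B : V → V → W) (Φ : W →ₗ[ℝ] W)
    (hadd : ∀ u v w, B u (v + w) = B u v + B u w) (hsmul : ∀ (c : ℝ) u v, B u (c • v) = c • B u v)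
    (hsymm : ∀ u v, B u v = B v u) (hΦ : ∀ x, Φ (Φ x) + x ∈ R) (hR : ∀ x ∈ R, Φ x ∈ R)
    {k : ℕ} (e : Fin k → V) (A : Fin k → Fin k → ℝ) (hA : ∀ i j, A i j = -A j i)
    (hB : ∀ j, Φ (B (e j) (e j)) - B (e j) (∑ i, A j i • e i) ∈ R) :
    ∑ j, B (e j) (e j) ∈ R := by
  have hsum (u : V) (c : Fin k → ℝ) : B u (∑ i, c i • e i) = ∑ i, c i • B u (e i) := by
    let b : V →ₗ[ℝ] W := { toFun := B u, map_add' := hadd u, map_smul' := fun c v ↦ hsmul c u v }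
    change b _ = ∑ i, c i • b (e i)
    simp
  -- Contraction of the symmetric `B` with the skew `A`: swapping the indices shows that the double
  -- sum equals its own negative.
  have h0 : ∑ j, B (e j) (∑ i, A j i • e i) = 0 := by
    simp_rw [hsum]
    have h : ∑ j, ∑ i, A j i • B (e j) (e i) = -∑ j, ∑ i, A j i • B (e j) (e i) := by
      conv_lhs => rw [Finset.sum_comm]
      simp_rw [← Finset.sum_neg_distrib]
      refine Finset.sum_congr rfl fun i _ ↦ Finset.sum_congr rfl fun j _ ↦ ?_
      rw [hA j i, hsymm (e j) (e i), neg_smul]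
    have h2 := add_eq_zero_iff_eq_neg.2 h
    rw [← two_smul ℝ] at h2
    exact (smul_eq_zero_iff_right two_ne_zero).1 h2
  have h1 : Φ (∑ j, B (e j) (e j)) ∈ R := by
    have := R.sum_mem (t := Finset.univ) fun j _ ↦ hB j
    rwa [Finset.sum_sub_distrib, h0, sub_zero, ← map_sum] at this
  simpa using R.sub_mem (hΦ (∑ j, B (e j) (e j))) (hR _ h1)

end LinearAlgebra

/-! ### Differentiating the invariance of the leaf directions -/

section Calculus

variable {E₀ E₁ E₂ E : Type*} [NormedAddCommGroup E₀] [NormedSpace ℝ E₀]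
  [NormedAddCommGroup E₁] [NormedSpace ℝ E₁] [FiniteDimensional ℝ E₁]
  [NormedAddCommGroup E₂] [NormedSpace ℝ E₂]
  [NormedAddCommGroup E] [NormedSpace ℝ E] [FiniteDimensional ℝ E]

/-- If `c z` lies in the range of the injective operator `a z` for `z` near `z₀`, and `c z₀ = 0`,
then the derivative of `c` at `z₀` takes values in the range of `a z₀`. -/
lemma fderiv_mem_range_of_eventually_mem_range {a : E₀ → E₁ →L[ℝ] E} {c : E₀ → E} {z₀ : E₀}
    (ha : DifferentiableAt ℝ a z₀) (hinj : Function.Injective (a z₀))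
    (hc : DifferentiableAt ℝ c z₀) (hc0 : c z₀ = 0)
    (hmem : ∀ᶠ z in 𝓝 z₀, ∃ j, c z = a z j) (v : E₀) :
    ∃ j, fderiv ℝ c z₀ v = a z₀ j := by
  have : CompleteSpace E₁ := FiniteDimensional.complete ℝ E₁
  -- A left inverse `L` of `a z₀` makes `L ∘ a z` invertible for `z` near `z₀`. Then `K z = a z ∘ (L
  -- ∘ a z)⁻¹ ∘ L` is a differentiable family of projections onto the ranges of `a z`.
  obtain ⟨L', hL'⟩ := LinearMap.exists_leftInverse_of_injective (a z₀).toLinearMap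
    (LinearMap.ker_eq_bot.2 hinj)
  let L : E →L[ℝ] E₁ := L'.toContinuousLinearMap
  have hL : L ∘L a z₀ = 1 := by
    ext x
    exact LinearMap.congr_fun hL' x
  have hN : DifferentiableAt ℝ (fun z ↦ L ∘L a z) z₀ :=
    (differentiableAt_const L).clm_comp ha
  have hinv : DifferentiableAt ℝ (fun z ↦ Ring.inverse (L ∘L a z)) z₀ := by
    refine DifferentiableAt.comp (g := Ring.inverse) z₀ ?_ hN
    rw [hL]
    exact differentiableAt_inverse isUnit_one
  have hunit : ∀ᶠ z in 𝓝 z₀, IsUnit (L ∘L a z) := by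
    have := hN.continuousAt
    apply this.eventually
    change ∀ᶠ y in 𝓝 (L ∘L a z₀), IsUnit y
    rw [hL]
    exact (Units.isOpen (R := E₁ →L[ℝ] E₁)).mem_nhds isUnit_one
  have hK : DifferentiableAt ℝ (fun z ↦ a z ∘L Ring.inverse (L ∘L a z) ∘L L) z₀ :=
    ha.clm_comp (hinv.clm_comp (differentiableAt_const L))
  -- In the product rule for `c = K c`, the term with the derivative of `K` drops out because `c z₀
  -- = 0`, leaving `c' = K z₀ c'`.
  have heq : c =ᶠ[𝓝 z₀] fun z ↦ (a z ∘L Ring.inverse (L ∘L a z) ∘L L) (c z) := by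
    filter_upwards [hunit, hmem] with z hz ⟨j, hj⟩
    have h := congrArg (fun f : E₁ →L[ℝ] E₁ ↦ a z (f j)) (Ring.inverse_mul_cancel _ hz)
    rw [hj]
    exact h.symm
  rw [heq.fderiv_eq, fderiv_clm_apply hK hc]
  refine ⟨Ring.inverse (L ∘L a z₀) (L (fderiv ℝ c z₀ v)), ?_⟩
  simp [hc0]

/-- A parallel field of endomorphisms `Φ` along a map `G` preserving the image of the first factor
commutes, modulo that image, with the Hessian `D²G + Γ(DG, DG)` of the map. -/
lemma exists_hessian_commutator_eq {G : E₁ × E₂ → E} {z₀ : E₁ × E₂} {Φ : E₁ × E₂ → E →L[ℝ] E}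
    {Γ : E → E → E} (hG : ContDiffAt ℝ 2 G z₀) (hΦ : DifferentiableAt ℝ Φ z₀)
    (hinj : Function.Injective (fderiv ℝ G z₀))
    (hpar : ∀ v c, fderiv ℝ Φ z₀ v c + Γ (fderiv ℝ G z₀ v) (Φ z₀ c)
      = Φ z₀ (Γ (fderiv ℝ G z₀ v) c))
    (hmem : ∀ᶠ z in 𝓝 z₀, ∀ w : E₁, ∃ j : E₁, Φ z (fderiv ℝ G z (w, 0)) = fderiv ℝ G z (j, 0))
    (v : E₁ × E₂) {w j : E₁} (hj : Φ z₀ (fderiv ℝ G z₀ (w, 0)) = fderiv ℝ G z₀ (j, 0)) :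
    ∃ r : E₁, Φ z₀ (fderiv ℝ (fderiv ℝ G) z₀ v (w, 0)
        + Γ (fderiv ℝ G z₀ v) (fderiv ℝ G z₀ (w, 0)))
      - (fderiv ℝ (fderiv ℝ G) z₀ v (j, 0) + Γ (fderiv ℝ G z₀ v) (fderiv ℝ G z₀ (j, 0)))
      = fderiv ℝ G z₀ (r, 0) := by
  have hG' : DifferentiableAt ℝ (fderiv ℝ G) z₀ :=
    (hG.fderiv_right (m := 1) (by norm_num)).differentiableAt one_ne_zero
  have hGw (u : E₁ × E₂) : DifferentiableAt ℝ (fun z ↦ fderiv ℝ G z u) z₀ :=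
    hG'.clm_apply (differentiableAt_const u)
  have hΦG : DifferentiableAt ℝ (fun z ↦ Φ z (fderiv ℝ G z (w, 0))) z₀ := hΦ.clm_apply (hGw _)
  -- The vectors `w` and `j` are frozen at their values at `z₀`. The difference `c` vanishes at `z₀`
  -- and stays in the moving image of the first factor, so its derivative lies in the image at `z₀`.
  obtain ⟨r, hr⟩ := fderiv_mem_range_of_eventually_mem_range
    (a := fun z ↦ fderiv ℝ G z ∘L ContinuousLinearMap.inl ℝ E₁ E₂)
    (c := fun z ↦ Φ z (fderiv ℝ G z (w, 0)) - fderiv ℝ G z (j, 0)) (z₀ := z₀)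
    (hG'.clm_comp (differentiableAt_const _))
    (fun x y hxy ↦ congrArg Prod.fst (hinj hxy))
    (hΦG.sub (hGw _)) (by simp [hj])
    (by
      filter_upwards [hmem] with z hz
      obtain ⟨i, hi⟩ := hz w
      refine ⟨i - j, ?_⟩
      rw [hi, ← map_sub]
      simp) v
  refine ⟨r, ?_⟩
  change _ = fderiv ℝ G z₀ (r, 0) at hr
  rw [← hr, fderiv_fun_sub hΦG (hGw _), fderiv_clm_apply hΦ (hGw _),
    fderiv_clm_apply hG' (differentiableAt_const _), fderiv_clm_apply hG' (differentiableAt_const _)]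
  have := hpar v (fderiv ℝ G z₀ (w, 0))
  rw [hj] at this
  simp only [map_add, ← this]
  simp
  abel

end Calculus

end CosymplecticWarped

namespace CosymplecticWarped

/-! ### Preferred trivializations and constant fields -/

section Coordinates

variable {E : Type*} [NormedAddCommGroup E] [NormedSpace ℝ E]
  {H : Type*} [TopologicalSpace H] {I : ModelWithCorners ℝ E H}
  {M : Type*} [TopologicalSpace M] [ChartedSpace H M]

lemma mvfderiv_congr {F : Type*} [NormedAddCommGroup F] [NormedSpace ℝ F] {g g' : M → F} {x : M}
    (h : g =ᶠ[𝓝 x] g') (v : TangentSpace I x) : mvfderiv I g x v = mvfderiv I g' x v := by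
  have := congrArg (fun L : TangentSpace I x →L[ℝ] F ↦ L v)
    (h.mfderiv_eq (I := I) (I' := 𝓘(ℝ, F)))
  exact this

variable [IsManifold I 1 M]

lemma trivializationAt_self_snd (x : M) (v : TangentSpace I x) :
    (trivializationAt E (TangentSpace I) x ⟨x, v⟩).2 = v :=
  (tangentBundleCore I M).coordChange_self (achart H x) x (mem_chart_source H x) v

lemma trivializationAt_self_symm (x : M) (v : E) :
    (trivializationAt E (fun y : M ↦ TangentSpace I y) x).symm x v = v := by
  have h := (trivializationAt E (fun y : M ↦ TangentSpace I y) x).symm_apply_apply_mk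
    (mem_chart_source H x) (v : TangentSpace I x)
  rwa [show (trivializationAt E (fun y : M ↦ TangentSpace I y) x ⟨x, v⟩).2 = v from
    trivializationAt_self_snd x v] at h

lemma trivializationAt_self_symmL (x : M) (v : E) :
    (trivializationAt E (fun y : M ↦ TangentSpace I y) x).symmL ℝ x v = v := by
  rw [Trivialization.symmL_apply _ (mem_chart_source H x), trivializationAt_self_symm]

lemma trivializationAt_snd_eq {x y : M} (hy : y ∈ (chartAt H x).source) (v : TangentSpace I y) :
    (trivializationAt E (TangentSpace I) x ⟨y, v⟩).2
      = (trivializationAt E (TangentSpace I) x).continuousLinearMapAt ℝ y v := by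
  rw [Trivialization.continuousLinearMapAt_apply, Trivialization.coe_linearMapAt_of_mem _ hy]

lemma extend_eq_symmL {x y : M} (hy : y ∈ (chartAt H x).source) (v : TangentSpace I x) :
    FiberBundle.extend E v y = (trivializationAt E (TangentSpace I) x).symmL ℝ y v := by
  rw [FiberBundle.extend, trivializationAt_self_snd]
  exact (Trivialization.symmL_apply _ hy _).symm

lemma trivializationAt_extend_snd {x y : M} (hy : y ∈ (chartAt H x).source)
    (v : TangentSpace I x) :
    (trivializationAt E (TangentSpace I) x ⟨y, FiberBundle.extend E v y⟩).2 = v := by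
  rw [trivializationAt_snd_eq hy, extend_eq_symmL hy]
  exact Trivialization.continuousLinearMapAt_symmL _ hy _

/-- Fields that are constant in a chart commute at its centre. -/
lemma mlieBracket_extend (x : M) (v w : TangentSpace I x) :
    VectorField.mlieBracket I (FiberBundle.extend E v) (FiberBundle.extend E w) x = 0 := by
  -- Pulled back to the chart, the extension of `u` is the constant field `u`; the bracket of two
  -- constant fields is zero.
  have key (u : TangentSpace I x) :
      VectorField.mpullbackWithin 𝓘(ℝ, E) I (extChartAt I x).symm (FiberBundle.extend E u)
        (Set.range I) =ᶠ[𝓝[Set.range I] (extChartAt I x x)] fun _ ↦ (u : E) := by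
    filter_upwards [extChartAt_target_mem_nhdsWithin x] with z hz
    have hs : (extChartAt I x).symm z ∈ (chartAt H x).source := by
      simpa using (extChartAt I x).map_target hz
    have hinv := isInvertible_mfderivWithin_extChartAt_symm hz
    rw [VectorField.mpullbackWithin_apply, extend_eq_symmL hs,
      TangentBundle.symmL_trivializationAt hs, (extChartAt I x).right_inv hz]
    exact hinv.inverse_apply_eq.2 rfl
  rw [← VectorField.mlieBracketWithin_univ, VectorField.mlieBracketWithin_apply]
  simp only [Set.preimage_univ, Set.univ_inter]
  rw [(key v).lieBracketWithin_vectorField_eq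
    ((key v).eq_of_nhdsWithin (by exact ⟨_, rfl⟩)) (key w)
    ((key w).eq_of_nhdsWithin (by exact ⟨_, rfl⟩))]
  have h0 (v w : E) : VectorField.lieBracketWithin ℝ (fun _ : E ↦ v) (fun _ ↦ w) (Set.range I)
      (extChartAt I x x) = 0 := by
    rw [VectorField.lieBracketWithin_eq]
    simp
  exact (congrArg _ (h0 v w)).trans (map_zero _)

end Coordinates

/-! ### Connections in a chart -/

section Connection

variable {E : Type*} [NormedAddCommGroup E] [NormedSpace ℝ E]
  {M : Type*} [TopologicalSpace M] [ChartedSpace E M] [IsManifold 𝓘(ℝ, E) ∞ M]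

/-- The flat connection given near `x₀` by the preferred trivialization at `x₀`. -/
noncomputable def flatConnection (x₀ : M) (s : ∀ y : M, TangentSpace 𝓘(ℝ, E) y) (y : M) :
    TangentSpace 𝓘(ℝ, E) y →L[ℝ] TangentSpace 𝓘(ℝ, E) y :=
  (trivializationAt E (TangentSpace 𝓘(ℝ, E)) x₀).symmL ℝ y ∘L
    mvfderiv 𝓘(ℝ, E) (fun y' ↦ (trivializationAt E (TangentSpace 𝓘(ℝ, E)) x₀ ⟨y', s y'⟩).2) y

/-- Only the point `x₀` is needed: this connection serves as the reference from which `nabla`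
differs by a tensor at `x₀`. -/
lemma isCovariantDerivativeOn_flatConnection (x₀ : M) :
    IsCovariantDerivativeOn (I := 𝓘(ℝ, E)) E (flatConnection (E := E) x₀) {x₀} where
  add {σ σ' x} hσ hσ' hx := by
    obtain rfl : x = x₀ := hx
    have h := mvfderiv_add (mdifferentiableAt_totalSpace 𝓘(ℝ, E) _ |>.1 hσ).2
      (mdifferentiableAt_totalSpace 𝓘(ℝ, E) _ |>.1 hσ').2
    ext v
    simp only [flatConnection, ContinuousLinearMap.comp_apply, add_apply,
      ← map_add]
    congr 1
    rw [← add_apply, ← h]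
    refine mvfderiv_congr ?_ v
    filter_upwards [(chartAt E x).open_source.mem_nhds (mem_chart_source E x)] with y hy
    simp only [Pi.add_apply]
    rw [trivializationAt_snd_eq hy, trivializationAt_snd_eq hy, trivializationAt_snd_eq hy, map_add]
  leibniz {σ g x} hσ hg hx := by
    obtain rfl : x = x₀ := hx
    have h := mvfderiv_smul hg (mdifferentiableAt_totalSpace 𝓘(ℝ, E) _ |>.1 hσ).2
    ext v
    have h1 : mvfderiv 𝓘(ℝ, E) (fun y' ↦ (trivializationAt E (TangentSpace 𝓘(ℝ, E)) x
        ⟨y', (g • σ) y'⟩).2) x v = mvfderiv 𝓘(ℝ, E) (g • fun y' ↦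
          (trivializationAt E (TangentSpace 𝓘(ℝ, E)) x ⟨y', σ y'⟩).2) x v := by
      refine mvfderiv_congr ?_ v
      filter_upwards [(chartAt E x).open_source.mem_nhds (mem_chart_source E x)] with y hy
      simp only [Pi.smul_apply', trivializationAt_snd_eq hy, map_smul]
    simp only [flatConnection, ContinuousLinearMap.comp_apply, add_apply,
      smul_apply, ContinuousLinearMap.smulRight_apply]
    rw [h1, h]
    simp only [add_apply, smul_apply,
      ContinuousLinearMap.smulRight_apply, map_add, map_smul]
    congr 2
    rw [trivializationAt_snd_eq (mem_chart_source E x)]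
    exact Trivialization.symmL_continuousLinearMapAt _ (mem_chart_source E x) _

/-- A connection in the preferred trivialization at `x`: it differs from the flat connection by
its value on constant fields. -/
lemma covariantDerivative_eq_add [FiniteDimensional ℝ E]
    (nabla : CovariantDerivative 𝓘(ℝ, E) E (fun x : M ↦ TangentSpace 𝓘(ℝ, E) x))
    {x : M} {Y : ∀ y : M, TangentSpace 𝓘(ℝ, E) y}
    (hY : MDifferentiableAt 𝓘(ℝ, E) (𝓘(ℝ, E).prod 𝓘(ℝ, E))
      (fun y ↦ TotalSpace.mk' E (E := fun y : M ↦ TangentSpace 𝓘(ℝ, E) y) y (Y y)) x)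
    (v : TangentSpace 𝓘(ℝ, E) x) :
    nabla Y x v = (trivializationAt E (TangentSpace 𝓘(ℝ, E)) x).symm x
        (mvfderiv 𝓘(ℝ, E) (fun y ↦ (trivializationAt E (TangentSpace 𝓘(ℝ, E)) x ⟨y, Y y⟩).2) x v)
      + nabla (FiberBundle.extend E (Y x)) x v := by
  have hc := nabla.isCovariantDerivativeOn (s := {x})
  have hf := isCovariantDerivativeOn_flatConnection (E := E) x
  have hext := FiberBundle.mdifferentiableAt_extend 𝓘(ℝ, E) E (Y x)
  -- The difference of the two connections is tensorial, so it may be computed on the constant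
  -- extension of `Y x`, whose flat derivative is zero.
  have h1 := hc.difference_apply hf rfl hY
  have h2 := hc.difference_apply hf rfl hext
  rw [FiberBundle.extend_apply_self, h1] at h2
  have h3 : flatConnection x (FiberBundle.extend E (Y x)) x v = 0 := by
    have : mvfderiv 𝓘(ℝ, E) (fun y' ↦ (trivializationAt E (TangentSpace 𝓘(ℝ, E)) x
        ⟨y', FiberBundle.extend E (Y x) y'⟩).2) x v
          = mvfderiv 𝓘(ℝ, E) (fun _ : M ↦ (show E from Y x)) x v := by
      refine mvfderiv_congr ?_ v
      filter_upwards [(chartAt E x).open_source.mem_nhds (mem_chart_source E x)] with y hy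
      exact trivializationAt_extend_snd hy _
    rw [mvfderiv_const] at this
    exact (congrArg ((trivializationAt E (TangentSpace 𝓘(ℝ, E)) x).symmL ℝ x) this).trans
      (map_zero ((trivializationAt E (TangentSpace 𝓘(ℝ, E)) x).symmL ℝ x))
  have h4 := congrArg (fun L : TangentSpace 𝓘(ℝ, E) x →L[ℝ] TangentSpace 𝓘(ℝ, E) x ↦ L v) h2
  simp only [sub_apply, h3, sub_zero] at h4
  rw [← h4, ← Trivialization.symmL_apply (R := ℝ) _ (mem_chart_source E x)]
  exact (add_sub_cancel _ _).symm

/-- Symmetry of the Christoffel symbols: the torsion vanishes and constant fields have zero bracket.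
-/
lemma IsLeviCivita.symm_extend [FiniteDimensional ℝ E]
    [RiemannianBundle (fun x : M ↦ TangentSpace 𝓘(ℝ, E) x)]
    {nabla : CovariantDerivative 𝓘(ℝ, E) E (fun x : M ↦ TangentSpace 𝓘(ℝ, E) x)}
    (h : IsLeviCivita nabla) (x : M) (v w : TangentSpace 𝓘(ℝ, E) x) :
    nabla (FiberBundle.extend E w) x v = nabla (FiberBundle.extend E v) x w := by
  have h1 := nabla.torsion_apply_eq_extend v w
  rw [h.1, mlieBracket_extend, FiberBundle.extend_apply_self, FiberBundle.extend_apply_self,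
    sub_zero] at h1
  exact (sub_eq_zero.1 h1.symm)

end Connection

end CosymplecticWarped

namespace CosymplecticWarped

/-! ### The tensor field `φ` in a chart -/

section StructureInCoordinates

variable {E : Type*} [NormedAddCommGroup E] [NormedSpace ℝ E]
  {M : Type*} [TopologicalSpace M] [ChartedSpace E M] [IsManifold 𝓘(ℝ, E) ∞ M]
  [RiemannianBundle (fun x : M ↦ TangentSpace 𝓘(ℝ, E) x)]

/-- The tensor field `φ` at `y` in the preferred trivialization at `x`. -/
noncomputable def AlmostContactMetricStructure.coordφ (S : AlmostContactMetricStructure E M)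
    (x y : M) : E →L[ℝ] E :=
  ContinuousLinearMap.inCoordinates E (TangentSpace 𝓘(ℝ, E)) E (TangentSpace 𝓘(ℝ, E)) x y x y
    (S.φ y)

lemma AlmostContactMetricStructure.mdifferentiableAt_coordφ
    (S : AlmostContactMetricStructure E M) (x : M) :
    MDifferentiableAt 𝓘(ℝ, E) 𝓘(ℝ, E →L[ℝ] E) (S.coordφ x) x :=
  ((contMDiffAt_hom_bundle _).1 (S.smooth_φ x)).2.mdifferentiableAt (by simp)

lemma AlmostContactMetricStructure.coordφ_self (S : AlmostContactMetricStructure E M) (x : M)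
    (c : TangentSpace 𝓘(ℝ, E) x) : S.coordφ x x c = S.φ x c := by
  change (trivializationAt E (TangentSpace 𝓘(ℝ, E)) x).continuousLinearMapAt ℝ x
    (S.φ x ((trivializationAt E (TangentSpace 𝓘(ℝ, E)) x).symmL ℝ x c)) = _
  rw [show (trivializationAt E (TangentSpace 𝓘(ℝ, E)) x).symmL ℝ x c = c from
    trivializationAt_self_symmL (I := 𝓘(ℝ, E)) (E := E) x c, ← trivializationAt_snd_eq (mem_chart_source E x),
    trivializationAt_self_snd]

lemma AlmostContactMetricStructure.coordφ_continuousLinearMapAt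
    (S : AlmostContactMetricStructure E M) {x y : M} (hy : y ∈ (chartAt E x).source)
    (u : TangentSpace 𝓘(ℝ, E) y) :
    S.coordφ x y ((trivializationAt E (TangentSpace 𝓘(ℝ, E)) x).continuousLinearMapAt ℝ y u)
      = (trivializationAt E (TangentSpace 𝓘(ℝ, E)) x).continuousLinearMapAt ℝ y (S.φ y u) := by
  change (trivializationAt E (TangentSpace 𝓘(ℝ, E)) x).continuousLinearMapAt ℝ y
    (S.φ y ((trivializationAt E (TangentSpace 𝓘(ℝ, E)) x).symmL ℝ y
      ((trivializationAt E (TangentSpace 𝓘(ℝ, E)) x).continuousLinearMapAt ℝ y u))) = _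
  rw [Trivialization.symmL_continuousLinearMapAt _ hy]

/-- The condition `∇φ = 0` tested on the constant extension of `c`: the field `φ c` has flat
derivative `(∂_v φ) c`, to which `covariantDerivative_eq_add` adds the Christoffel term. -/
lemma AlmostContactMetricStructure.IsCosymplectic.mvfderiv_coordφ [FiniteDimensional ℝ E]
    {S : AlmostContactMetricStructure E M}
    {nabla : CovariantDerivative 𝓘(ℝ, E) E (fun x : M ↦ TangentSpace 𝓘(ℝ, E) x)}
    (hS : S.IsCosymplectic nabla) (x : M) (v c : TangentSpace 𝓘(ℝ, E) x) :
    (trivializationAt E (TangentSpace 𝓘(ℝ, E)) x).symm x (mvfderiv 𝓘(ℝ, E) (S.coordφ x) x v c)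
      + nabla (FiberBundle.extend E (S.φ x c)) x v
      = S.φ x (nabla (FiberBundle.extend E c) x v) := by
  have hext := FiberBundle.mdifferentiableAt_extend 𝓘(ℝ, E) E c
  have hφ : MDifferentiableAt 𝓘(ℝ, E) (𝓘(ℝ, E).prod 𝓘(ℝ, E →L[ℝ] E))
      (fun x ↦ TotalSpace.mk' (E →L[ℝ] E)
        (E := fun x : M ↦ TangentSpace 𝓘(ℝ, E) x →L[ℝ] TangentSpace 𝓘(ℝ, E) x) x (S.φ x)) x :=
    (S.smooth_φ x).mdifferentiableAt (by simp)
  have hY := MDifferentiableAt.clm_bundle_apply hφ hext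
  rw [← hS x _ hext v, covariantDerivative_eq_add nabla hY v,
    FiberBundle.extend_apply_self]
  have h1 := (ContinuousLinearMap.apply (E := E) ℝ E c).hasMFDerivAt.comp x
    (S.mdifferentiableAt_coordφ x).hasMFDerivAt
  have h2 : mvfderiv 𝓘(ℝ, E) (fun y ↦ S.coordφ x y c) x v
      = mvfderiv 𝓘(ℝ, E) (S.coordφ x) x v c :=
    congrArg (fun L : TangentSpace 𝓘(ℝ, E) x →L[ℝ] E ↦ L v) h1.mfderiv
  have h3 : mvfderiv 𝓘(ℝ, E) (fun y ↦ (trivializationAt E (TangentSpace 𝓘(ℝ, E)) x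
      ⟨y, S.φ y (FiberBundle.extend E c y)⟩).2) x v = mvfderiv 𝓘(ℝ, E) (S.coordφ x) x v c := by
    rw [← h2]
    refine mvfderiv_congr ?_ v
    filter_upwards [(chartAt E x).open_source.mem_nhds (mem_chart_source E x)] with y hy
    rw [trivializationAt_snd_eq hy, extend_eq_symmL hy]
    rfl
  rw [h3]

end StructureInCoordinates

/-! ### First and second derivatives of a map in charts -/

section MapInCoordinates

lemma eventually_mem_chart_source {E H' M P : Type*} [TopologicalSpace E] [TopologicalSpace H']
    [TopologicalSpace M] [ChartedSpace E M] [TopologicalSpace P] [ChartedSpace H' P] {F : P → M} {p : P} (hF : ContinuousAt F p) :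
    ∀ᶠ q in 𝓝 p, q ∈ (chartAt H' p).source ∧ F q ∈ (chartAt E (F p)).source :=
  .and ((chartAt H' p).open_source.mem_nhds (mem_chart_source H' p))
    (hF.eventually ((chartAt E (F p)).open_source.mem_nhds (mem_chart_source E (F p))))

variable {E : Type*} [NormedAddCommGroup E] [NormedSpace ℝ E]
  {M : Type*} [TopologicalSpace M] [ChartedSpace E M]
  {E' : Type*} [NormedAddCommGroup E'] [NormedSpace ℝ E']
  {H' : Type*} [TopologicalSpace H'] {I' : ModelWithCorners ℝ E' H'} [I'.Boundaryless]
  {P : Type*} [TopologicalSpace P] [ChartedSpace H' P]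

variable (E I') in
/-- The map `F` in the preferred charts at `p` and `F p`. -/
noncomputable def coordMap (F : P → M) (p : P) : E' → E :=
  extChartAt 𝓘(ℝ, E) (F p) ∘ F ∘ (extChartAt I' p).symm

lemma contDiffAt_coordMap {F : P → M} {p : P} (hF : ContMDiffAt I' 𝓘(ℝ, E) ∞ F p) :
    ContDiffAt ℝ ∞ (coordMap E I' F p) (extChartAt I' p p) := by
  have := (contMDiffAt_iff.1 hF).2
  rwa [I'.range_eq_univ, contDiffWithinAt_univ] at this

lemma fderiv_coordMap_self {F : P → M} {p : P} (hF : ContMDiffAt I' 𝓘(ℝ, E) ∞ F p) (v : E') :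
    fderiv ℝ (coordMap E I' F p) (extChartAt I' p p) v = mfderiv I' 𝓘(ℝ, E) F p v := by
  have h := (hF.mdifferentiableAt (by simp)).mfderiv
  rw [I'.range_eq_univ, fderivWithin_univ] at h
  exact (congrArg (fun L : E' →L[ℝ] E ↦ L v) h).symm

variable [IsManifold 𝓘(ℝ, E) ∞ M] [IsManifold I' ∞ P]

/-- The chain rule, with the derivatives of the charts at `p` and `F p` read as the tangent bundle
trivializations. Having it at all `q` near `p`, and not just at `p`, is what permits a second
differentiation. -/
lemma fderiv_coordMap_apply {F : P → M} (hF : ContMDiff I' 𝓘(ℝ, E) ∞ F) {p q : P}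
    (hq : q ∈ (chartAt H' p).source) (hFq : F q ∈ (chartAt E (F p)).source) (w : E') :
    fderiv ℝ (coordMap E I' F p) (extChartAt I' p q) w
      = (trivializationAt E (TangentSpace 𝓘(ℝ, E)) (F p)).continuousLinearMapAt ℝ (F q)
        (mfderiv I' 𝓘(ℝ, E) F q
          ((trivializationAt E' (fun q : P ↦ TangentSpace I' q) p).symmL ℝ q w)) := by
  have hq' : (extChartAt I' p).symm (extChartAt I' p q) = q :=
    (extChartAt I' p).left_inv (by simpa using hq)
  have h1 : HasMFDerivAt 𝓘(ℝ, E') I' (extChartAt I' p).symm (extChartAt I' p q)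
      ((trivializationAt E' (TangentSpace I') p).symmL ℝ q) := by
    have := (mdifferentiableWithinAt_extChartAt_symm (I := I')
      ((extChartAt I' p).map_source (by simpa using hq))).hasMFDerivWithinAt
    rw [TangentBundle.symmL_trivializationAt hq]
    rw [I'.range_eq_univ] at this ⊢
    exact hasMFDerivWithinAt_univ.1 this
  have h2 : HasMFDerivAt I' 𝓘(ℝ, E) F ((extChartAt I' p).symm (extChartAt I' p q))
      (mfderiv I' 𝓘(ℝ, E) F q) := by
    rw [hq']
    exact ((hF q).mdifferentiableAt (by simp)).hasMFDerivAt
  have h3 : HasMFDerivAt 𝓘(ℝ, E) 𝓘(ℝ, E) (extChartAt 𝓘(ℝ, E) (F p))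
      (F ((extChartAt I' p).symm (extChartAt I' p q)))
      ((trivializationAt E (TangentSpace 𝓘(ℝ, E)) (F p)).continuousLinearMapAt ℝ (F q)) := by
    rw [hq', TangentBundle.continuousLinearMapAt_trivializationAt hFq]
    exact (mdifferentiableAt_extChartAt hFq).hasMFDerivAt
  have h4 : HasMFDerivAt 𝓘(ℝ, E') 𝓘(ℝ, E) (coordMap E I' F p) (extChartAt I' p q) _ :=
    h3.comp (extChartAt I' p q) (h2.comp (extChartAt I' p q) h1)
  obtain ⟨L, hL⟩ : ∃ L : E' →L[ℝ] E, L = (trivializationAt E (TangentSpace 𝓘(ℝ, E))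
      (F p)).continuousLinearMapAt ℝ (F q) ∘L (mfderiv I' 𝓘(ℝ, E) F q) ∘L
        (trivializationAt E' (fun q : P ↦ TangentSpace I' q) p).symmL ℝ q := ⟨_, rfl⟩
  have h5 : HasFDerivAt (coordMap E I' F p) L (extChartAt I' p q) := by
    rw [hL]
    exact h4.hasFDerivAt
  rw [h5.fderiv, hL]
  rfl

/-- The Hessian of `F`, in the preferred charts at `p` and `F p`. -/
lemma covAlong_mfderiv_extend
    (nabla : CovariantDerivative 𝓘(ℝ, E) E (fun x : M ↦ TangentSpace 𝓘(ℝ, E) x))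
    {F : P → M} (hF : ContMDiff I' 𝓘(ℝ, E) ∞ F) (p : P) (v w : E') :
    covAlong (I' := I') nabla F (fun q ↦ mfderiv I' 𝓘(ℝ, E) F q
        (FiberBundle.extend E' (E := fun q : P ↦ TangentSpace I' q) (x := p) w q)) p v
      = (trivializationAt E (TangentSpace 𝓘(ℝ, E)) (F p)).symm (F p)
          (fderiv ℝ (fderiv ℝ (coordMap E I' F p)) (extChartAt I' p p) v w)
        + nabla (FiberBundle.extend E (mfderiv I' 𝓘(ℝ, E) F p w)) (F p)
          (mfderiv I' 𝓘(ℝ, E) F p v) := by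
  have hw : FiberBundle.extend E' (E := fun q : P ↦ TangentSpace I' q) (x := p) w p = w :=
    FiberBundle.extend_apply_self _ _
  unfold covAlong
  beta_reduce
  rw [hw]
  congr 2
  have hd : DifferentiableAt ℝ (fderiv ℝ (coordMap E I' F p)) (extChartAt I' p p) :=
    ((contDiffAt_coordMap (hF p)).of_le (m := 2) 
      (WithTop.coe_le_coe.2 (le_top : (2 : ℕ∞) ≤ ⊤))).fderiv_right (m := 1)
      (by norm_num) |>.differentiableAt one_ne_zero
  have h1 := ((hd.clm_apply (differentiableAt_const w)).hasFDerivAt.hasMFDerivAt.comp p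
      (mdifferentiableAt_extChartAt (I := I') (mem_chart_source H' p)).hasMFDerivAt).mfderiv
  rw [mfderiv_extChartAt_self] at h1
  have h3 : fderiv ℝ (fun z ↦ fderiv ℝ (coordMap E I' F p) z w) (extChartAt I' p p) v
      = fderiv ℝ (fderiv ℝ (coordMap E I' F p)) (extChartAt I' p p) v w := by
    rw [fderiv_clm_apply hd (differentiableAt_const _)]
    simp
  have h2 : mvfderiv I' (fun q ↦ fderiv ℝ (coordMap E I' F p) (extChartAt I' p q) w) p v
      = fderiv ℝ (fderiv ℝ (coordMap E I' F p)) (extChartAt I' p p) v w := by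
    refine (congrArg (fun L : E' →L[ℝ] E ↦ L v) h1).trans ?_
    exact h3
  -- Near `p`, the field `dF(W)` with `W` the constant extension of `w` has coordinates `q ↦ DG(q)
  -- w`, where `G` is `F` in charts.
  refine Eq.trans ?_ h2
  refine mvfderiv_congr ?_ v
  filter_upwards [eventually_mem_chart_source (E := E) (H' := H') (hF p).continuousAt] with q ⟨hq, hFq⟩
  rw [fderiv_coordMap_apply hF hq hFq]
  change (trivializationAt E (TangentSpace 𝓘(ℝ, E)) (F p) ⟨F q, _⟩).2 = _
  rw [trivializationAt_snd_eq hFq]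
  exact congrArg (fun u ↦ (trivializationAt E (TangentSpace 𝓘(ℝ, E)) (F p)).continuousLinearMapAt ℝ
    (F q) (mfderiv I' 𝓘(ℝ, E) F q u)) (extend_eq_symmL hq w)

end MapInCoordinates

end CosymplecticWarped

namespace CosymplecticWarped

/-! ### Algebra of almost contact metric structures -/

section AlmostContact

variable {E : Type*} [NormedAddCommGroup E] [NormedSpace ℝ E]
  {M : Type*} [TopologicalSpace M] [ChartedSpace E M] [IsManifold 𝓘(ℝ, E) ∞ M]
  [RiemannianBundle (fun x : M ↦ TangentSpace 𝓘(ℝ, E) x)]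
  (S : AlmostContactMetricStructure E M)

namespace AlmostContactMetricStructure

/-- From `φ²ξ = -ξ + ξ = 0`, evaluating `φ²` on `φξ` gives `φξ = cξ` with `c = η(φξ)`. Applying `φ`
again gives `c φξ = 0`, so either factor being zero forces the claim. -/
lemma φ_ξ (x : M) : S.φ x (S.ξ x) = 0 := by
  have h1 : S.φ x (S.φ x (S.ξ x)) = 0 := by simp [S.φ_φ, S.η_ξ]
  have h2 := S.φ_φ x (S.φ x (S.ξ x))
  rw [h1, map_zero] at h2
  have h3 : S.φ x (S.ξ x) = S.η x (S.φ x (S.ξ x)) • S.ξ x := (neg_add_eq_zero.1 h2.symm)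
  have h4 := congrArg (S.φ x) h3
  rw [h1, map_smul] at h4
  rcases smul_eq_zero.1 h4.symm with h | h
  · rw [h3, h, zero_smul]
  · exact h

/-- Compare the two ways of expanding `φ³X`. -/
lemma η_φ (x : M) (X : TangentSpace 𝓘(ℝ, E) x) : S.η x (S.φ x X) = 0 := by
  have h1 := S.φ_φ x (S.φ x X)
  rw [S.φ_φ x X, map_add, map_smul, S.φ_ξ, smul_zero, add_zero, map_neg] at h1
  have h2 := congrArg (S.η x) (left_eq_add.1 h1)
  simpa [S.η_ξ] using h2

lemma inner_ξ_right (x : M) (X : TangentSpace 𝓘(ℝ, E) x) : inner ℝ X (S.ξ x) = S.η x X := by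
  have h := S.inner_φ_φ x X (S.ξ x)
  rw [S.φ_ξ, inner_zero_right, S.η_ξ] at h
  linarith

/-- Put `φY` in place of `Y` in the compatibility of `φ` with the metric; the `η` terms vanish by
`η_φ`. -/
lemma inner_φ_left (x : M) (X Y : TangentSpace 𝓘(ℝ, E) x) :
    inner ℝ (S.φ x X) Y = -inner ℝ X (S.φ x Y) := by
  have h := S.inner_φ_φ x X (S.φ x Y)
  rw [S.φ_φ, S.η_φ, mul_zero, sub_zero, inner_add_right, inner_neg_right, inner_smul_right,
    S.inner_ξ_right, S.η_φ] at h
  linarith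

end AlmostContactMetricStructure

end AlmostContact

/-! ### The first factor in product charts -/

section ProductCharts

variable {E₁ : Type*} [NormedAddCommGroup E₁] [NormedSpace ℝ E₁]
  {N₁ : Type*} [TopologicalSpace N₁] [ChartedSpace E₁ N₁]
  {E₂ : Type*} [NormedAddCommGroup E₂] [NormedSpace ℝ E₂]
  {N₂ : Type*} [TopologicalSpace N₂] [ChartedSpace E₂ N₂]

lemma mem_firstFactor_iff (p : N₁ × N₂) (v : TangentSpace (𝓘(ℝ, E₁).prod 𝓘(ℝ, E₂)) p) :
    v ∈ firstFactor p ↔ Prod.snd (α := E₁) (β := E₂) v = 0 := by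
  rw [firstFactor, LinearMap.mem_ker, mfderiv_snd]
  rfl

variable [IsManifold 𝓘(ℝ, E₁) ∞ N₁] [IsManifold 𝓘(ℝ, E₂) ∞ N₂]

lemma continuousLinearMapAt_prod_snd {p q : N₁ × N₂}
    (hq : q ∈ (chartAt (ModelProd E₁ E₂) p).source)
    (u : TangentSpace (𝓘(ℝ, E₁).prod 𝓘(ℝ, E₂)) q) :
    ((trivializationAt (E₁ × E₂) (TangentSpace (𝓘(ℝ, E₁).prod 𝓘(ℝ, E₂))) p).continuousLinearMapAt
      ℝ q u).2 = (trivializationAt E₂ (TangentSpace 𝓘(ℝ, E₂)) p.2).continuousLinearMapAt ℝ q.2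
        (Prod.snd (α := E₁) (β := E₂) u) := by
  have hq2 : q.2 ∈ (chartAt E₂ p.2).source := hq.2
  have h1 := (mdifferentiableAt_extChartAt (I := 𝓘(ℝ, E₁).prod 𝓘(ℝ, E₂)) hq).hasMFDerivAt
  have h2 := (mdifferentiableAt_extChartAt (I := 𝓘(ℝ, E₂)) hq2).hasMFDerivAt
  have h3 := (ContinuousLinearMap.snd ℝ E₁ E₂).hasMFDerivAt.comp q h1
  have h4 := h2.comp q (hasMFDerivAt_snd (I := 𝓘(ℝ, E₁)) (I' := 𝓘(ℝ, E₂)) q)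
  have h5 := hasMFDerivAt_unique h3 h4
  rw [TangentBundle.continuousLinearMapAt_trivializationAt hq,
    TangentBundle.continuousLinearMapAt_trivializationAt hq2]
  exact congrArg (fun L : E₁ × E₂ →L[ℝ] E₂ ↦ L u) h5

/-- Charts of a product are products of charts, so in the trivialization at `p` the leaf directions
at every nearby `q` are the fixed subspace `E₁ × 0`. -/
lemma mem_firstFactor_iff_continuousLinearMapAt {p q : N₁ × N₂}
    (hq : q ∈ (chartAt (ModelProd E₁ E₂) p).source)
    (u : TangentSpace (𝓘(ℝ, E₁).prod 𝓘(ℝ, E₂)) q) :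
    u ∈ firstFactor q ↔
      ((trivializationAt (E₁ × E₂) (TangentSpace (𝓘(ℝ, E₁).prod 𝓘(ℝ, E₂))) p).continuousLinearMapAt
        ℝ q u).2 = 0 := by
  have hq2 : q.2 ∈ (chartAt E₂ p.2).source := hq.2
  rw [mem_firstFactor_iff, continuousLinearMapAt_prod_snd hq]
  constructor
  · intro h
    rw [h]
    exact map_zero _
  · intro h
    have := Trivialization.symmL_continuousLinearMapAt (R := ℝ)
      (trivializationAt E₂ (TangentSpace 𝓘(ℝ, E₂)) p.2) hq2 (Prod.snd (α := E₁) (β := E₂) u)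
    rw [h, map_zero] at this
    exact this.symm

end ProductCharts

end CosymplecticWarped

namespace CosymplecticWarped

/-! ### The contact CR conditions in charts -/

section ContactCR

variable {E : Type*} [NormedAddCommGroup E] [NormedSpace ℝ E]
  {M : Type*} [TopologicalSpace M] [ChartedSpace E M] [IsManifold 𝓘(ℝ, E) ∞ M]
  [RiemannianBundle (fun x : M ↦ TangentSpace 𝓘(ℝ, E) x)]
  {E₁ : Type*} [NormedAddCommGroup E₁] [NormedSpace ℝ E₁]
  {N₁ : Type*} [TopologicalSpace N₁] [ChartedSpace E₁ N₁] [IsManifold 𝓘(ℝ, E₁) ∞ N₁]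
  {E₂ : Type*} [NormedAddCommGroup E₂] [NormedSpace ℝ E₂]
  {N₂ : Type*} [TopologicalSpace N₂] [ChartedSpace E₂ N₂] [IsManifold 𝓘(ℝ, E₂) ∞ N₂]

lemma hasFDerivAt_coordφ_comp (S : AlmostContactMetricStructure E M) {F : N₁ × N₂ → M}
    (hF : ContMDiff (𝓘(ℝ, E₁).prod 𝓘(ℝ, E₂)) 𝓘(ℝ, E) ∞ F) (p : N₁ × N₂) :
    ∃ L : E₁ × E₂ →L[ℝ] E →L[ℝ] E,
      HasFDerivAt (fun z ↦ S.coordφ (F p) (F ((extChartAt (𝓘(ℝ, E₁).prod 𝓘(ℝ, E₂)) p).symm z)))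
        L (extChartAt (𝓘(ℝ, E₁).prod 𝓘(ℝ, E₂)) p p) ∧
      ∀ v, L v = mvfderiv 𝓘(ℝ, E) (S.coordφ (F p)) (F p)
        (mfderiv (𝓘(ℝ, E₁).prod 𝓘(ℝ, E₂)) 𝓘(ℝ, E) F p v) := by
  have hp := extChartAt_to_inv (I := 𝓘(ℝ, E₁).prod 𝓘(ℝ, E₂)) p
  have h1 : HasMFDerivAt 𝓘(ℝ, E₁ × E₂) (𝓘(ℝ, E₁).prod 𝓘(ℝ, E₂))
      (extChartAt (𝓘(ℝ, E₁).prod 𝓘(ℝ, E₂)) p).symm (extChartAt (𝓘(ℝ, E₁).prod 𝓘(ℝ, E₂)) p p)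
      (ContinuousLinearMap.id ℝ (E₁ × E₂)) := by
    have := (mdifferentiableWithinAt_extChartAt_symm (I := 𝓘(ℝ, E₁).prod 𝓘(ℝ, E₂))
      (mem_extChartAt_target (I := 𝓘(ℝ, E₁).prod 𝓘(ℝ, E₂)) p)).hasMFDerivWithinAt
    rw [mfderivWithin_range_extChartAt_symm, ModelWithCorners.range_eq_univ] at this
    exact hasMFDerivWithinAt_univ.1 this
  have h2 : HasMFDerivAt (𝓘(ℝ, E₁).prod 𝓘(ℝ, E₂)) 𝓘(ℝ, E) F
      ((extChartAt (𝓘(ℝ, E₁).prod 𝓘(ℝ, E₂)) p).symm (extChartAt (𝓘(ℝ, E₁).prod 𝓘(ℝ, E₂)) p p))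
      (mfderiv (𝓘(ℝ, E₁).prod 𝓘(ℝ, E₂)) 𝓘(ℝ, E) F p) := by
    rw [hp]
    exact ((hF p).mdifferentiableAt (by simp)).hasMFDerivAt
  have h3 : HasMFDerivAt 𝓘(ℝ, E) 𝓘(ℝ, E →L[ℝ] E) (S.coordφ (F p))
      (F ((extChartAt (𝓘(ℝ, E₁).prod 𝓘(ℝ, E₂)) p).symm
        (extChartAt (𝓘(ℝ, E₁).prod 𝓘(ℝ, E₂)) p p)))
      (mfderiv 𝓘(ℝ, E) 𝓘(ℝ, E →L[ℝ] E) (S.coordφ (F p)) (F p)) := by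
    rw [hp]
    exact (S.mdifferentiableAt_coordφ (F p)).hasMFDerivAt
  have h4 := h3.comp (extChartAt (𝓘(ℝ, E₁).prod 𝓘(ℝ, E₂)) p p)
    (h2.comp (extChartAt (𝓘(ℝ, E₁).prod 𝓘(ℝ, E₂)) p p) h1)
  exact ⟨_, h4.hasFDerivAt, fun v ↦ rfl⟩

variable [RiemannianBundle (fun x : N₁ ↦ TangentSpace 𝓘(ℝ, E₁) x)]
  [RiemannianBundle (fun x : N₂ ↦ TangentSpace 𝓘(ℝ, E₂) x)]

/-- The warped metric is positive definite because `f > 0`. -/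
lemma IsWarpedProductImmersion.injective_mfderiv {f : N₁ → ℝ} {F : N₁ × N₂ → M}
    (hF : IsWarpedProductImmersion (E₁ := E₁) (E₂ := E₂) (E := E) f F) (p : N₁ × N₂) :
    Function.Injective (mfderiv (𝓘(ℝ, E₁).prod 𝓘(ℝ, E₂)) 𝓘(ℝ, E) F p) := by
  rw [injective_iff_map_eq_zero]
  intro v hv
  have h := hF.isometric p v v
  rw [hv, inner_zero_left, warpedMetric, mfderiv_fst, mfderiv_snd] at h
  have h1 : (0 : ℝ) ≤ inner ℝ (ContinuousLinearMap.fst ℝ (TangentSpace 𝓘(ℝ, E₁) p.1)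
      (TangentSpace 𝓘(ℝ, E₂) p.2) v) (ContinuousLinearMap.fst ℝ (TangentSpace 𝓘(ℝ, E₁) p.1)
      (TangentSpace 𝓘(ℝ, E₂) p.2) v) := real_inner_self_nonneg
  have h2 : (0 : ℝ) ≤ inner ℝ (ContinuousLinearMap.snd ℝ (TangentSpace 𝓘(ℝ, E₁) p.1)
      (TangentSpace 𝓘(ℝ, E₂) p.2) v) (ContinuousLinearMap.snd ℝ (TangentSpace 𝓘(ℝ, E₁) p.1)
      (TangentSpace 𝓘(ℝ, E₂) p.2) v) := real_inner_self_nonneg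
  have hf : 0 < f p.1 ^ 2 := pow_pos (hF.f_pos _) 2
  have h3 := mul_nonneg hf.le h2
  have h6 := (add_eq_zero_iff_of_nonneg h1 h3).1 h.symm
  have h4 := inner_self_eq_zero.1 h6.1
  have h5 := inner_self_eq_zero.1 ((mul_eq_zero.1 h6.2).resolve_left hf.ne')
  exact Prod.ext h4 h5

variable {S : AlmostContactMetricStructure E M} {f : N₁ → ℝ} {F : N₁ × N₂ → M}

/-- Invariance of `TN_T` on a whole neighbourhood, in the form of the hypothesis `hmem` of
`exists_hessian_commutator_eq`. -/
lemma IsContactCRWarpedProduct.eventually_coordφ_mem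
    (hF : IsContactCRWarpedProduct (E₁ := E₁) (E₂ := E₂) S f F) (p : N₁ × N₂) :
    ∀ᶠ z in 𝓝 (extChartAt (𝓘(ℝ, E₁).prod 𝓘(ℝ, E₂)) p p), ∀ w : E₁, ∃ j : E₁,
      S.coordφ (F p) (F ((extChartAt (𝓘(ℝ, E₁).prod 𝓘(ℝ, E₂)) p).symm z))
          (fderiv ℝ (coordMap E (𝓘(ℝ, E₁).prod 𝓘(ℝ, E₂)) F p) z (w, 0))
        = fderiv ℝ (coordMap E (𝓘(ℝ, E₁).prod 𝓘(ℝ, E₂)) F p) z (j, 0) := by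
  have hsymm := continuousAt_extChartAt_symm (I := 𝓘(ℝ, E₁).prod 𝓘(ℝ, E₂)) p
  have hev := eventually_mem_chart_source (E := E) (H' := ModelProd E₁ E₂)
    (hF.smooth p).continuousAt
  rw [← extChartAt_to_inv (I := 𝓘(ℝ, E₁).prod 𝓘(ℝ, E₂)) p] at hev
  filter_upwards [hsymm.eventually hev, extChartAt_target_mem_nhds (I := 𝓘(ℝ, E₁).prod 𝓘(ℝ, E₂)) p]
    with z ⟨hq, hFq⟩ hz w
  rw [extChartAt_to_inv] at hq hFq
  obtain ⟨q, hqdef⟩ : ∃ q, q = (extChartAt (𝓘(ℝ, E₁).prod 𝓘(ℝ, E₂)) p).symm z := ⟨_, rfl⟩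
  have hzq : z = extChartAt (𝓘(ℝ, E₁).prod 𝓘(ℝ, E₂)) p q := by
    rw [hqdef, (extChartAt _ p).right_inv hz]
  rw [← hqdef] at hq hFq ⊢
  rw [hzq]
  simp only [fderiv_coordMap_apply hF.smooth hq hFq]
  obtain ⟨u, hu, hu'⟩ := hF.invariant q
    ((trivializationAt (E₁ × E₂) (fun q : N₁ × N₂ ↦ TangentSpace (𝓘(ℝ, E₁).prod 𝓘(ℝ, E₂)) q)
      p).symmL ℝ q (w, 0)) (by
        rw [mem_firstFactor_iff_continuousLinearMapAt hq,
          Trivialization.continuousLinearMapAt_symmL _ hq])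
  rw [S.coordφ_continuousLinearMapAt hFq, ← hu']
  rw [mem_firstFactor_iff_continuousLinearMapAt hq] at hu
  refine ⟨((trivializationAt (E₁ × E₂) (TangentSpace (𝓘(ℝ, E₁).prod 𝓘(ℝ, E₂)))
    p).continuousLinearMapAt ℝ q u).1, ?_⟩
  rw [← hu, Prod.mk.eta, Trivialization.symmL_continuousLinearMapAt _ hq]

end ContactCR

end CosymplecticWarped

namespace CosymplecticWarped

/-! ### The Hessian, its trace and minimality -/

section Minimality

variable {E : Type*} [NormedAddCommGroup E] [NormedSpace ℝ E] [FiniteDimensional ℝ E]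
  {M : Type*} [TopologicalSpace M] [ChartedSpace E M] [IsManifold 𝓘(ℝ, E) ∞ M]
  [RiemannianBundle (fun x : M ↦ TangentSpace 𝓘(ℝ, E) x)]
  {E₁ : Type*} [NormedAddCommGroup E₁] [NormedSpace ℝ E₁] [FiniteDimensional ℝ E₁]
  {N₁ : Type*} [TopologicalSpace N₁] [ChartedSpace E₁ N₁] [IsManifold 𝓘(ℝ, E₁) ∞ N₁]
  [RiemannianBundle (fun x : N₁ ↦ TangentSpace 𝓘(ℝ, E₁) x)]
  {E₂ : Type*} [NormedAddCommGroup E₂] [NormedSpace ℝ E₂] [FiniteDimensional ℝ E₂]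
  {N₂ : Type*} [TopologicalSpace N₂] [ChartedSpace E₂ N₂] [IsManifold 𝓘(ℝ, E₂) ∞ N₂]
  [RiemannianBundle (fun x : N₂ ↦ TangentSpace 𝓘(ℝ, E₂) x)]
  {nabla : CovariantDerivative 𝓘(ℝ, E) E (fun x : M ↦ TangentSpace 𝓘(ℝ, E) x)}
  {S : AlmostContactMetricStructure E M} {f : N₁ → ℝ} {F : N₁ × N₂ → M}

/-- The Christoffel symbols of a connection at the centre of the preferred chart at `x`. -/
noncomputable def christoffel
    (nabla : CovariantDerivative 𝓘(ℝ, E) E (fun x : M ↦ TangentSpace 𝓘(ℝ, E) x)) (x : M)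
    (a b : E) : E :=
  nabla (FiberBundle.extend E (E := fun x : M ↦ TangentSpace 𝓘(ℝ, E) x) (x := x) b) x a

lemma christoffel_symm (hnabla : IsLeviCivita nabla) (x : M) (a b : E) :
    christoffel nabla x a b = christoffel nabla x b a :=
  hnabla.symm_extend x a b

lemma christoffel_add_left (x : M) (a b c : E) :
    christoffel nabla x (a + b) c = christoffel nabla x a c + christoffel nabla x b c :=
  map_add (nabla (FiberBundle.extend E (E := fun x : M ↦ TangentSpace 𝓘(ℝ, E) x) (x := x) c) x) a b

lemma christoffel_smul_left (x : M) (r : ℝ) (a c : E) :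
    christoffel nabla x (r • a) c = r • christoffel nabla x a c :=
  map_smul (nabla (FiberBundle.extend E (E := fun x : M ↦ TangentSpace 𝓘(ℝ, E) x) (x := x) c) x)
    r a

lemma AlmostContactMetricStructure.IsCosymplectic.christoffel_coordφ (hS : S.IsCosymplectic nabla)
    (x : M) (L : E →L[ℝ] E) (v c : E)
    (hL : L = mvfderiv 𝓘(ℝ, E) (S.coordφ x) x (v : TangentSpace 𝓘(ℝ, E) x)) :
    L c + christoffel nabla x v (S.coordφ x x c)
      = S.coordφ x x (christoffel nabla x v c) := by
  have h := hS.mvfderiv_coordφ x v c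
  rw [trivializationAt_self_symm] at h
  exact (congrArg₂ (fun (A : E →L[ℝ] E) (b : E) ↦ A c + christoffel nabla x v b) hL
    (S.coordφ_self x c)).trans (h.trans (S.coordφ_self x _).symm)

/-- The differential of `F` at `p`, in the preferred charts at `p` and `F p`. -/
noncomputable def coordDeriv (F : N₁ × N₂ → M) (p : N₁ × N₂) : E₁ × E₂ →L[ℝ] E :=
  fderiv ℝ (coordMap E (𝓘(ℝ, E₁).prod 𝓘(ℝ, E₂)) F p) (extChartAt (𝓘(ℝ, E₁).prod 𝓘(ℝ, E₂)) p p)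

lemma coordDeriv_apply (hF : ContMDiff (𝓘(ℝ, E₁).prod 𝓘(ℝ, E₂)) 𝓘(ℝ, E) ∞ F) (p : N₁ × N₂)
    (v : E₁ × E₂) : coordDeriv (E := E) F p v = mfderiv (𝓘(ℝ, E₁).prod 𝓘(ℝ, E₂)) 𝓘(ℝ, E) F p v :=
  fderiv_coordMap_self (hF p) v

/-- The Hessian of `F` at `p`, in the preferred charts at `p` and `F p`. -/
noncomputable def coordHessian
    (nabla : CovariantDerivative 𝓘(ℝ, E) E (fun x : M ↦ TangentSpace 𝓘(ℝ, E) x))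
    (F : N₁ × N₂ → M) (p : N₁ × N₂) (v w : E₁ × E₂) : E :=
  fderiv ℝ (fderiv ℝ (coordMap E (𝓘(ℝ, E₁).prod 𝓘(ℝ, E₂)) F p))
      (extChartAt (𝓘(ℝ, E₁).prod 𝓘(ℝ, E₂)) p p) v w
    + christoffel nabla (F p) (coordDeriv F p v) (coordDeriv F p w)

lemma covAlong_eq_coordHessian (hF : ContMDiff (𝓘(ℝ, E₁).prod 𝓘(ℝ, E₂)) 𝓘(ℝ, E) ∞ F)
    (p : N₁ × N₂) (v w : TangentSpace (𝓘(ℝ, E₁).prod 𝓘(ℝ, E₂)) p) :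
    covAlong nabla F (fun q ↦ mfderiv (𝓘(ℝ, E₁).prod 𝓘(ℝ, E₂)) 𝓘(ℝ, E) F q
        (FiberBundle.extend (E₁ × E₂)
          (E := fun q : N₁ × N₂ ↦ TangentSpace (𝓘(ℝ, E₁).prod 𝓘(ℝ, E₂)) q) w q)) p v
      = coordHessian nabla F p v w := by
  have h := covAlong_mfderiv_extend nabla hF p v w
  rw [trivializationAt_self_symm] at h
  refine h.trans ?_
  exact congrArg₂ (fun a b : E ↦ fderiv ℝ (fderiv ℝ (coordMap E (𝓘(ℝ, E₁).prod 𝓘(ℝ, E₂)) F p))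
      (extChartAt (𝓘(ℝ, E₁).prod 𝓘(ℝ, E₂)) p p) v w + christoffel nabla (F p) a b)
    (coordDeriv_apply hF p v).symm (coordDeriv_apply hF p w).symm

lemma coordHessian_symm (hnabla : IsLeviCivita nabla)
    (hF : ContMDiff (𝓘(ℝ, E₁).prod 𝓘(ℝ, E₂)) 𝓘(ℝ, E) ∞ F) (p : N₁ × N₂) (v w : E₁ × E₂) :
    coordHessian nabla F p v w = coordHessian nabla F p w v := by
  have h : IsSymmSndFDerivAt ℝ (coordMap E (𝓘(ℝ, E₁).prod 𝓘(ℝ, E₂)) F p)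
      (extChartAt (𝓘(ℝ, E₁).prod 𝓘(ℝ, E₂)) p p) := by
    refine (contDiffAt_coordMap (hF p)).isSymmSndFDerivAt ?_
    rw [minSmoothness_of_isRCLikeNormedField]
    exact WithTop.coe_le_coe.2 (le_top : (2 : ℕ∞) ≤ ⊤)
  rw [coordHessian, coordHessian, h v w, christoffel_symm hnabla]

lemma coordHessian_add_left (p : N₁ × N₂) (u v w : E₁ × E₂) :
    coordHessian nabla F p (u + v) w
      = coordHessian nabla F p u w + coordHessian nabla F p v w := by
  simp only [coordHessian, map_add, add_apply, christoffel_add_left]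
  abel

lemma coordHessian_smul_left (p : N₁ × N₂) (c : ℝ) (v w : E₁ × E₂) :
    coordHessian nabla F p (c • v) w = c • coordHessian nabla F p v w := by
  simp only [coordHessian, map_smul, smul_apply, christoffel_smul_left, smul_add]

/-- The tangent space of the leaf of the first factor, as a subspace of the ambient model space. -/
noncomputable def leafImage (F : N₁ × N₂ → M) (p : N₁ × N₂) : Submodule ℝ E :=
  LinearMap.range (coordDeriv F p ∘L ContinuousLinearMap.inl ℝ E₁ E₂).toLinearMap

lemma mem_leafImage_of_mem_firstFactor
    (hF : ContMDiff (𝓘(ℝ, E₁).prod 𝓘(ℝ, E₂)) 𝓘(ℝ, E) ∞ F) {p : N₁ × N₂}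
    {v : TangentSpace (𝓘(ℝ, E₁).prod 𝓘(ℝ, E₂)) p} (hv : v ∈ firstFactor p) :
    mfderiv (𝓘(ℝ, E₁).prod 𝓘(ℝ, E₂)) 𝓘(ℝ, E) F p v ∈ leafImage (E := E) (E₁ := E₁) (E₂ := E₂) F p := by
  have h : ((Prod.fst (α := E₁) (β := E₂) v, 0) : E₁ × E₂) = v :=
    Prod.ext rfl ((mem_firstFactor_iff p v).1 hv).symm
  exact ⟨Prod.fst (α := E₁) (β := E₂) v, (congrArg (coordDeriv (E := E) F p) h).trans
    (coordDeriv_apply hF p v)⟩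

lemma exists_firstFactor_of_mem_leafImage
    (hF : ContMDiff (𝓘(ℝ, E₁).prod 𝓘(ℝ, E₂)) 𝓘(ℝ, E) ∞ F) {p : N₁ × N₂} {x : E}
    (hx : x ∈ leafImage (E := E) (E₁ := E₁) (E₂ := E₂) F p) :
    ∃ v ∈ firstFactor (E₁ := E₁) (E₂ := E₂) p,
      mfderiv (𝓘(ℝ, E₁).prod 𝓘(ℝ, E₂)) 𝓘(ℝ, E) F p v = x := by
  obtain ⟨j, rfl⟩ := hx
  exact ⟨(j, 0), (mem_firstFactor_iff p _).2 rfl, (coordDeriv_apply hF p (j, 0)).symm⟩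

lemma IsContactCRWarpedProduct.commutator_mem_leafImage (hS : S.IsCosymplectic nabla)
    (hF : IsContactCRWarpedProduct (E₁ := E₁) (E₂ := E₂) S f F) (p : N₁ × N₂)
    (v w j : TangentSpace (𝓘(ℝ, E₁).prod 𝓘(ℝ, E₂)) p) (hw : w ∈ firstFactor p)
    (hj : j ∈ firstFactor p)
    (hjw : mfderiv (𝓘(ℝ, E₁).prod 𝓘(ℝ, E₂)) 𝓘(ℝ, E) F p j
      = S.φ (F p) (mfderiv (𝓘(ℝ, E₁).prod 𝓘(ℝ, E₂)) 𝓘(ℝ, E) F p w)) :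
    S.coordφ (F p) (F p) (coordHessian nabla F p v w) - coordHessian nabla F p v j
      ∈ leafImage (E := E) (E₁ := E₁) (E₂ := E₂) F p := by
  obtain ⟨L, hL, hLv⟩ := hasFDerivAt_coordφ_comp S hF.smooth p
  have hp := extChartAt_to_inv (I := 𝓘(ℝ, E₁).prod 𝓘(ℝ, E₂)) p
  obtain ⟨w₁, rfl⟩ : ∃ w₁ : E₁, w = ((w₁, 0) : E₁ × E₂) :=
    ⟨Prod.fst (α := E₁) (β := E₂) w, Prod.ext rfl ((mem_firstFactor_iff p w).1 hw)⟩
  obtain ⟨j₁, rfl⟩ : ∃ j₁ : E₁, j = ((j₁, 0) : E₁ × E₂) :=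
    ⟨Prod.fst (α := E₁) (β := E₂) j, Prod.ext rfl ((mem_firstFactor_iff p j).1 hj)⟩
  have hd := coordDeriv_apply (E := E) (E₁ := E₁) (E₂ := E₂) hF.smooth p
  have hinj : Function.Injective (coordDeriv (E := E) (E₁ := E₁) (E₂ := E₂) F p) := fun a b hab ↦
    hF.injective_mfderiv p (((hd a).symm.trans hab).trans (hd b))
  have hpar (a : E₁ × E₂) (c : E) : L a c
      + christoffel nabla (F p) (coordDeriv F p a) (S.coordφ (F p) (F p) c)
        = S.coordφ (F p) (F p) (christoffel nabla (F p) (coordDeriv F p a) c) :=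
    hS.christoffel_coordφ (F p) (L a) (coordDeriv F p a) c
      ((hLv a).trans (congrArg (mvfderiv 𝓘(ℝ, E) (S.coordφ (F p)) (F p)) (hd a).symm))
  have hjw' : S.coordφ (F p) (F p) (coordDeriv F p ((w₁, 0) : E₁ × E₂))
      = coordDeriv F p ((j₁, 0) : E₁ × E₂) :=
    (S.coordφ_self _ _).trans ((congrArg (S.φ (F p)) (hd (w₁, 0))).trans
      (hjw.symm.trans (hd (j₁, 0)).symm))
  obtain ⟨r, hr⟩ := exists_hessian_commutator_eq (Γ := christoffel nabla (F p))
    ((contDiffAt_coordMap (hF.smooth p)).of_le (WithTop.coe_le_coe.2 (le_top : (2 : ℕ∞) ≤ ⊤)))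
    hL.differentiableAt hinj (by rw [hL.fderiv, hp]; exact hpar) (hF.eventually_coordφ_mem p) v
    (w := w₁) (j := j₁) (by rw [hp]; exact hjw')
  rw [hp] at hr
  exact ⟨r, hr.symm⟩

/-- Here `φ²x + x = η(x) ξ`, and `ξ` is tangent to the leaf. -/
lemma IsContactCRWarpedProduct.coordφ_coordφ_add_mem_leafImage
    (hF : IsContactCRWarpedProduct (E₁ := E₁) (E₂ := E₂) S f F) (p : N₁ × N₂) (x : E) :
    S.coordφ (F p) (F p) (S.coordφ (F p) (F p) x) + x
      ∈ leafImage (E := E) (E₁ := E₁) (E₂ := E₂) F p := by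
  obtain ⟨v, hv, hv'⟩ := hF.ξ_tangent p
  have h1 := (leafImage (E := E) (E₁ := E₁) (E₂ := E₂) F p).smul_mem (S.η (F p) x)
    (mem_leafImage_of_mem_firstFactor hF.smooth hv)
  obtain ⟨r, hr⟩ : ∃ r : E, r = S.η (F p) x • S.ξ (F p) := ⟨_, rfl⟩
  have h2 : S.coordφ (F p) (F p) (S.coordφ (F p) (F p) x) = -x + r :=
    (S.coordφ_self _ _).trans ((congrArg (S.φ (F p)) (S.coordφ_self _ _)).trans
      ((S.φ_φ (F p) x).trans (congrArg (fun y : E ↦ -x + y) hr.symm)))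
  rw [hv'] at h1
  rw [h2, neg_add_cancel_comm, hr]
  exact h1

lemma IsContactCRWarpedProduct.coordφ_mem_leafImage
    (hF : IsContactCRWarpedProduct (E₁ := E₁) (E₂ := E₂) S f F) (p : N₁ × N₂) {x : E}
    (hx : x ∈ leafImage (E := E) (E₁ := E₁) (E₂ := E₂) F p) :
    S.coordφ (F p) (F p) x ∈ leafImage (E := E) (E₁ := E₁) (E₂ := E₂) F p := by
  obtain ⟨v, hv, rfl⟩ := exists_firstFactor_of_mem_leafImage hF.smooth hx
  obtain ⟨w, hw, hw'⟩ := hF.invariant p v hv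
  have h := mem_leafImage_of_mem_firstFactor hF.smooth hw
  rw [hw'] at h
  rw [S.coordφ_self]
  exact h

/-- By orthonormality the coefficients of `J e_j` are `⟨φ e_j, e_i⟩`, and `φ` is skew-adjoint. -/
lemma IsContactCRWarpedProduct.exists_skew_coefficients
    (hF : IsContactCRWarpedProduct (E₁ := E₁) (E₂ := E₂) S f F) (p : N₁ × N₂)
    {D : Submodule ℝ (TangentSpace (𝓘(ℝ, E₁).prod 𝓘(ℝ, E₂)) p)} {k : ℕ}
    {e J : Fin k → TangentSpace (𝓘(ℝ, E₁).prod 𝓘(ℝ, E₂)) p} (he : IsOrthonormalFrame f p D e)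
    (hJD : ∀ i, J i ∈ D)
    (hJ : ∀ i, mfderiv (𝓘(ℝ, E₁).prod 𝓘(ℝ, E₂)) 𝓘(ℝ, E) F p (J i)
      = S.φ (F p) (mfderiv (𝓘(ℝ, E₁).prod 𝓘(ℝ, E₂)) 𝓘(ℝ, E) F p (e i))) :
    ∃ A : Fin k → Fin k → ℝ, (∀ i j, A i j = -A j i) ∧ ∀ j, ∑ i, A j i • e i = J j := by
  obtain ⟨horth, hspan⟩ := he
  have hJspan (j : Fin k) : ∃ c : Fin k → ℝ, ∑ i, c i • e i = J j := by
    rw [← Submodule.mem_span_range_iff_exists_fun, hspan]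
    exact hJD j
  choose A hA using hJspan
  have hAinner (j i : Fin k) : A j i = inner ℝ
      (S.φ (F p) (mfderiv (𝓘(ℝ, E₁).prod 𝓘(ℝ, E₂)) 𝓘(ℝ, E) F p (e j)))
      (mfderiv (𝓘(ℝ, E₁).prod 𝓘(ℝ, E₂)) 𝓘(ℝ, E) F p (e i)) := by
    rw [← hJ, ← hA, map_sum, sum_inner]
    simp_rw [map_smul, inner_smul_left, hF.isometric, horth]
    simp
  refine ⟨A, fun i j ↦ ?_, hA⟩
  rw [hAinner, hAinner, S.inner_φ_left, real_inner_comm]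

lemma IsContactCRWarpedProduct.sum_coordHessian_mem_leafImage (hnabla : IsLeviCivita nabla)
    (hS : S.IsCosymplectic nabla) (hF : IsContactCRWarpedProduct (E₁ := E₁) (E₂ := E₂) S f F)
    (p : N₁ × N₂) {D : Submodule ℝ (TangentSpace (𝓘(ℝ, E₁).prod 𝓘(ℝ, E₂)) p)}
    (hD : D ≤ firstFactor p)
    (hinv : ∀ v ∈ D, ∃ w ∈ D, mfderiv (𝓘(ℝ, E₁).prod 𝓘(ℝ, E₂)) 𝓘(ℝ, E) F p w
      = S.φ (F p) (mfderiv (𝓘(ℝ, E₁).prod 𝓘(ℝ, E₂)) 𝓘(ℝ, E) F p v))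
    {k : ℕ} {e : Fin k → TangentSpace (𝓘(ℝ, E₁).prod 𝓘(ℝ, E₂)) p}
    (he : IsOrthonormalFrame f p D e) :
    ∑ j, coordHessian nabla F p (e j) (e j) ∈ leafImage (E := E) (E₁ := E₁) (E₂ := E₂) F p := by
  have heD (i : Fin k) : e i ∈ D := he.2 ▸ Submodule.subset_span ⟨i, rfl⟩
  choose J hJD hJ using fun i ↦ hinv (e i) (heD i)
  obtain ⟨A, hskew, hA⟩ := hF.exists_skew_coefficients p he hJD hJ
  refine sum_mem_of_skew (V := E₁ × E₂) _ (coordHessian nabla F p)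
    (S.coordφ (F p) (F p)).toLinearMap
    (fun u v w ↦ ?_) (fun c u v ↦ ?_) (coordHessian_symm hnabla hF.smooth p)
    (hF.coordφ_coordφ_add_mem_leafImage p) (fun x ↦ hF.coordφ_mem_leafImage p) e A hskew
    (fun j ↦ ?_)
  · rw [coordHessian_symm hnabla hF.smooth, coordHessian_add_left,
      coordHessian_symm hnabla hF.smooth p v, coordHessian_symm hnabla hF.smooth p w]
  · rw [coordHessian_symm hnabla hF.smooth, coordHessian_smul_left,
      coordHessian_symm hnabla hF.smooth p v]
  · have h := hF.commutator_mem_leafImage hS p (e j) (e j) (J j) (hD (heD j)) (hD (hJD j)) (hJ j)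
    rw [← hA j] at h
    exact h

/-- The normal projection is linear and kills tangent vectors, so only the trace of the unprojected
Hessian matters. -/
lemma sum_secondFundamentalForm_eq_zero (p : N₁ × N₂) {k : ℕ}
    (e : Fin k → TangentSpace (𝓘(ℝ, E₁).prod 𝓘(ℝ, E₂)) p)
    (h : ∑ i, covAlong nabla F (fun p' ↦ mfderiv (𝓘(ℝ, E₁).prod 𝓘(ℝ, E₂)) 𝓘(ℝ, E) F p'
        (FiberBundle.extend (E₁ × E₂)
          (E := fun q : N₁ × N₂ ↦ TangentSpace (𝓘(ℝ, E₁).prod 𝓘(ℝ, E₂)) q) (e i) p')) p (e i)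
      ∈ tangentImage (𝓘(ℝ, E₁).prod 𝓘(ℝ, E₂)) F p) :
    ∑ i, secondFundamentalForm nabla F p (e i) (e i) = 0 := by
  have : FiniteDimensional ℝ (TangentSpace 𝓘(ℝ, E) (F p)) :=
    inferInstanceAs (FiniteDimensional ℝ E)
  unfold secondFundamentalForm
  rw [← map_sum]
  exact Submodule.starProjection_orthogonal_apply_eq_zero h

/-- The trace of the second fundamental form vanishes over every distribution in the tangent
spaces of the leaves of the first factor that is invariant under `φ`. -/
theorem IsContactCRWarpedProduct.isMinimalOn_of_invariant (hnabla : IsLeviCivita nabla)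
    (hS : S.IsCosymplectic nabla) (hF : IsContactCRWarpedProduct (E₁ := E₁) (E₂ := E₂) S f F)
    (D : ∀ p : N₁ × N₂, Submodule ℝ (TangentSpace (𝓘(ℝ, E₁).prod 𝓘(ℝ, E₂)) p))
    (hD : ∀ p, D p ≤ firstFactor p)
    (hinv : ∀ p, ∀ v ∈ D p, ∃ w ∈ D p, mfderiv (𝓘(ℝ, E₁).prod 𝓘(ℝ, E₂)) 𝓘(ℝ, E) F p w
      = S.φ (F p) (mfderiv (𝓘(ℝ, E₁).prod 𝓘(ℝ, E₂)) 𝓘(ℝ, E) F p v)) :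
    IsMinimalOn (E₁ := E₁) (E₂ := E₂) nabla f F D := by
  intro p k e he
  obtain ⟨v, -, hv⟩ := exists_firstFactor_of_mem_leafImage hF.smooth
    (hF.sum_coordHessian_mem_leafImage hnabla hS p (hD p) (hinv p) he)
  refine sum_secondFundamentalForm_eq_zero p e ⟨v, hv.trans ?_⟩
  exact Finset.sum_congr rfl fun i _ ↦ (covAlong_eq_coordHessian hF.smooth p (e i) (e i)).symm

end Minimality

end CosymplecticWarped

theorem corollary3p1
    {E : Type*} [NormedAddCommGroup E] [NormedSpace ℝ E] [FiniteDimensional ℝ E]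
    {M : Type*} [TopologicalSpace M] [T2Space M] [ChartedSpace E M] [IsManifold 𝓘(ℝ, E) ∞ M]
    [RiemannianBundle (fun x : M ↦ TangentSpace 𝓘(ℝ, E) x)]
    [IsContMDiffRiemannianBundle 𝓘(ℝ, E) ∞ E (fun x : M ↦ TangentSpace 𝓘(ℝ, E) x)]
    {E₁ : Type*} [NormedAddCommGroup E₁] [NormedSpace ℝ E₁] [FiniteDimensional ℝ E₁]
    {NT : Type*} [TopologicalSpace NT] [T2Space NT] [ChartedSpace E₁ NT]
    [IsManifold 𝓘(ℝ, E₁) ∞ NT]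
    [RiemannianBundle (fun x : NT ↦ TangentSpace 𝓘(ℝ, E₁) x)]
    [IsContMDiffRiemannianBundle 𝓘(ℝ, E₁) ∞ E₁ (fun x : NT ↦ TangentSpace 𝓘(ℝ, E₁) x)]
    {E₂ : Type*} [NormedAddCommGroup E₂] [NormedSpace ℝ E₂] [FiniteDimensional ℝ E₂]
    {Nperp : Type*} [TopologicalSpace Nperp] [T2Space Nperp] [ChartedSpace E₂ Nperp]
    [IsManifold 𝓘(ℝ, E₂) ∞ Nperp]
    [RiemannianBundle (fun x : Nperp ↦ TangentSpace 𝓘(ℝ, E₂) x)]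
    [IsContMDiffRiemannianBundle 𝓘(ℝ, E₂) ∞ E₂ (fun x : Nperp ↦ TangentSpace 𝓘(ℝ, E₂) x)]
    (nabla : CovariantDerivative 𝓘(ℝ, E) E (fun x : M ↦ TangentSpace 𝓘(ℝ, E) x))
    (hnabla : IsLeviCivita nabla)
    (S : AlmostContactMetricStructure E M) (hS : S.IsCosymplectic nabla)
    (f : NT → ℝ) (F : NT × Nperp → M)
    (hF : IsContactCRWarpedProduct (E₁ := E₁) (E₂ := E₂) S f F) :
    IsMinimalOn (E₁ := E₁) (E₂ := E₂) nabla f F firstFactor ∧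
      IsMinimalOn (E₁ := E₁) (E₂ := E₂) nabla f F (firstFactorPerpξ S F) := by
  refine ⟨hF.isMinimalOn_of_invariant hnabla hS _ (fun _ ↦ le_rfl) hF.invariant,
    hF.isMinimalOn_of_invariant hnabla hS _ (fun _ ↦ inf_le_left) fun p v hv ↦ ?_⟩
  obtain ⟨w, hw, hw'⟩ := hF.invariant p v hv.1
  refine ⟨w, ⟨hw, ?_⟩, hw'⟩
  -- The complement of `ξ` is also `φ`-invariant: `⟨φv, ξ⟩ = -⟨v, φξ⟩ = 0`.
  change mfderiv (𝓘(ℝ, E₁).prod 𝓘(ℝ, E₂)) 𝓘(ℝ, E) F p w ∈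
    Submodule.orthogonal (Submodule.span ℝ {S.ξ (F p)})
  rw [hw', Submodule.mem_orthogonal_singleton_iff_inner_left, S.inner_φ_left, S.φ_ξ,
    inner_zero_right, neg_zero]
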